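/- Let $M$ be a smooth (Hausdorff, paracompact) manifold of dimension $n\ge 3$, let $\tau:T^\circ M\to M$ be its slit tangent bundle (zero section removed) with induced coordinates $(x^i,y^i)$, let $\Delta=y^i\,\partial/\partial y^i$ be the Liouville field, and let $\Gamma$ be a spray: a smooth vector field on $T^\circ M$ with $\tau_*\Gamma_{(x,y)}=y$ and $[\Delta,\Gamma]=\Gamma$. Write $\Gamma=y^i\partial/\partial x^i-2\Gamma^i\partial/\partial y^i$, $\Gamma^i_j=\partial\Gamma^i/\partial y^j$, $V_i=\partial/\partial y^i$, $H_i=\partial/\partial x^i-\Gamma^j_i\,\partial/\partial y^j$, $J=V_i\otimes dx^i$, $H=H_i\otimes dx^i$. For a type $(1,1)$ tensor field $K$ let $d_K=i_Kd-d\,i_K$. Define $R^l_{ij}$ by $[H_i,H_j]=-R^l_{ij}V_l$, put $R^k_j=R^k_{jl}y^l$, $R=R^m_m/(n-1)$, $A^k_j=R^k_j-R\,\delta^k_j$, and let $$W^k_j=A^k_j-\frac{1}{n+1}\,\frac{\partial A^m_j}{\partial y^m}\,y^k$$ be the projective Weyl tensor. For an open set $U\subset M$, a smooth type $(0,2)$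 tensor field $h=h_{ij}(x,y)$ along $\tau$, defined over $\tau^{-1}(U)$, satisfies the Helmholtz conditions if $$h_{ji}=h_{ij},\quad h_{ij}y^j=0,\quad \frac{\partial h_{ij}}{\partial y^k}=\frac{\partial h_{ik}}{\partial y^j},\quad (\nabla h)_{ij}:=\Gamma(h_{ij})-\Gamma^k_ih_{kj}-\Gamma^k_jh_{ik}=0,\quad h_{ik}W^k_j=h_{jk}W^k_i .$$ Let $U\subset M$ be open. (1) If a smooth semi-basic 1-form $\theta=\theta_i\,dx^i$ on $\tau^{-1}(U)$ satisfies $\mathcal L_\Delta\theta=0$, $d_J\theta=0$ and $d_H\theta=0$, then $h_{ij}=V_i(\theta_j)$ are the components of a smooth tensor field along $\tau$ over $\tau^{-1}(U)$, and $h$ satisfies the Helmholtz conditions. (2) Conversely, if a smooth tensor field $h$ along $\tau$ over $\tau^{-1}(U)$ satisfies the Helmholtz conditions, then every point of $U$ has an open neighbourhood $W\subset U$ such that on $\tau^{-1}(W)$ there is a smooth semi-basic 1-form $\theta$ with $\mathcal L_\Delta\theta=0$, $d_J\theta=0$, $d_H\theta=0$ and $h_{ij}=V_i(\theta_j)$.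 -/

import Mathlib

open scoped Manifold ContDiff

noncomputable section

namespace SprayGeometry

/-! ## Coordinate calculus on the induced coordinates `(x, y)` of a tangent bundle

Points, and tangent vectors at points, of a coordinate patch of the tangent bundle of an
`n`-dimensional manifold are pairs in `ℝⁿ × ℝⁿ`. -/

/-- The model space `ℝⁿ` of the base. -/
abbrev Base (n : ℕ) : Type := EuclideanSpace ℝ (Fin n)

/-- The space of induced coordinates `(x, y)`. -/
abbrev Phase (n : ℕ) : Type := Base n × Base n

variable {n : ℕ}

/-- The coordinate vector field `∂/∂xⁱ`. -/
def ddx (i : Fin n) : Phase n := (EuclideanSpace.single i 1, 0)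

/-- The coordinate vector field `Vᵢ = ∂/∂yⁱ`. -/
def ddy (i : Fin n) : Phase n := (0, EuclideanSpace.single i 1)

/-- The coordinate 1-form `dxⁱ`. -/
def dx (i : Fin n) : Phase n →L[ℝ] ℝ :=
  (EuclideanSpace.proj i : Base n →L[ℝ] ℝ).comp (ContinuousLinearMap.fst ℝ (Base n) (Base n))

/-- The derivative `Vᵢ(f) = ∂f/∂yⁱ`. -/
def V (i : Fin n) (f : Phase n → ℝ) (z : Phase n) : ℝ := fderiv ℝ f z (ddy i)

/-- The Liouville field `Δ = yⁱ ∂/∂yⁱ`. -/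
def liouville (z : Phase n) : Phase n := (0, z.2)

/-- `Γⁱⱼ = ∂Γⁱ/∂yʲ`, for spray coefficients `G i = Γⁱ`. -/
def gammaCoeff (G : Fin n → Phase n → ℝ) (i j : Fin n) (z : Phase n) : ℝ := V j (G i) z

/-- The horizontal field `Hᵢ = ∂/∂xⁱ - Γʲᵢ ∂/∂yʲ`. -/
def horField (G : Fin n → Phase n → ℝ) (i : Fin n) (z : Phase n) : Phase n :=
  ddx i - ∑ j, gammaCoeff G j i z • ddy j

/-- The derivative `Hᵢ(f)`. -/
def H (G : Fin n → Phase n → ℝ) (i : Fin n) (f : Phase n → ℝ) (z : Phase n) : ℝ :=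
  fderiv ℝ f z (horField G i z)

/-- The tangent structure `J = Vᵢ ⊗ dxⁱ`. -/
def tangentStructure (_z : Phase n) : Phase n →L[ℝ] Phase n := ∑ i, (dx i).smulRight (ddy i)

/-- The horizontal projector `H = Hᵢ ⊗ dxⁱ`. -/
def horProj (G : Fin n → Phase n → ℝ) (z : Phase n) : Phase n →L[ℝ] Phase n :=
  ∑ i, (dx i).smulRight (horField G i z)

/-- The curvature components `Rˡᵢⱼ = Hᵢ(Γˡⱼ) - Hⱼ(Γˡᵢ)`, so that `[Hᵢ, Hⱼ] = -Rˡᵢⱼ Vₗ`. -/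
def curvature (G : Fin n → Phase n → ℝ) (l i j : Fin n) (z : Phase n) : ℝ :=
  H G i (gammaCoeff G l j) z - H G j (gammaCoeff G l i) z

/-- The Jacobi endomorphism (Riemann curvature) `Rᵏⱼ = Rᵏⱼₗ yˡ`. -/
def jacobi (G : Fin n → Phase n → ℝ) (k j : Fin n) (z : Phase n) : ℝ :=
  ∑ l, curvature G k j l z * z.2 l

/-- `Aᵏⱼ = Rᵏⱼ - R δᵏⱼ`, where `R = Rᵐₘ / (n - 1)`. -/
def jacobiTraceAdjusted (G : Fin n → Phase n → ℝ) (k j : Fin n) (z : Phase n) : ℝ :=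
  jacobi G k j z - if k = j then (∑ m, jacobi G m m z) / ((n : ℝ) - 1) else 0

/-- The projective Weyl tensor `Wᵏⱼ = Aᵏⱼ - (1 / (n + 1)) (∂Aᵐⱼ/∂yᵐ) yᵏ`. -/
def weyl (G : Fin n → Phase n → ℝ) (k j : Fin n) (z : Phase n) : ℝ :=
  jacobiTraceAdjusted G k j z
    - (1 / ((n : ℝ) + 1)) * (∑ m, V m (jacobiTraceAdjusted G m j) z) * z.2 k

/-- The exterior derivative `dα` of a 1-form: `dα(u, v)`. -/
def extD (α : Phase n → Phase n →L[ℝ] ℝ) (z u v : Phase n) : ℝ :=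
  fderiv ℝ α z u v - fderiv ℝ α z v u

/-- The derivation `d_K α = i_K dα - d i_K α` of a 1-form `α` along a type (1,1) tensor field `K`,
where `i_K α = α ∘ K` and `(i_K ω)(u, v) = ω(K u, v) + ω(u, K v)`. -/
def extDAlong (K : Phase n → Phase n →L[ℝ] Phase n) (α : Phase n → Phase n →L[ℝ] ℝ)
    (z u v : Phase n) : ℝ :=
  extD α z (K z u) v + extD α z u (K z v) - extD (fun w => (α w).comp (K w)) z u v

/-- The Lie derivative `L_X α` of a 1-form along a vector field. -/
def lieD (X : Phase n → Phase n) (α : Phase n → Phase n →L[ℝ] ℝ) (z v : Phase n) : ℝ :=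
  fderiv ℝ α z (X z) v + α z (fderiv ℝ X z v)

/-! ## Objects on the slit tangent bundle of a manifold -/

variable {M : Type*} [TopologicalSpace M] [ChartedSpace (Base n) M] [IsManifold (𝓡 n) ∞ M]

/-- The parametrization `(x, y) ↦ yⁱ ∂/∂xⁱ` of the tangent bundle induced by a chart of `M`. -/
def param (e : OpenPartialHomeomorph M (Base n)) (z : Phase n) : TangentBundle (𝓡 n) M :=
  ⟨e.symm z.1, mfderiv (𝓡 n) (𝓡 n) e.symm z.1 z.2⟩

/-- The induced coordinates `(x, y)` on the tangent bundle, for a chart of `M`. -/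
def coords (e : OpenPartialHomeomorph M (Base n)) (q : TangentBundle (𝓡 n) M) : Phase n :=
  (e q.proj, mfderiv (𝓡 n) (𝓡 n) e q.proj q.2)

/-- The coordinate image of `τ⁻¹(U)`, where `τ` is the slit tangent bundle projection, in the
induced coordinates of a chart. -/
def slitDomain (U : Set M) (e : OpenPartialHomeomorph M (Base n)) : Set (Phase n) :=
  {z | z.1 ∈ e.target ∧ e.symm z.1 ∈ U ∧ z.2 ≠ 0}

variable (n M) in
/-- Vector fields on the tangent bundle (only the values off the zero section are used). -/
abbrev TVectorField : Type _ :=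
  (q : TangentBundle (𝓡 n) M) → TangentSpace (𝓡 n).tangent q

variable (n M) in
/-- 1-forms on the tangent bundle (only the values off the zero section are used). -/
abbrev TOneForm : Type _ :=
  (q : TangentBundle (𝓡 n) M) → TangentSpace (𝓡 n).tangent q →L[ℝ] ℝ

variable (n M) in
/-- Type (0,2) tensor fields along the tangent bundle projection (only the values off the zero
section are used): to `(x, y)` is assigned a bilinear form on `TₓM`. -/
abbrev Multiplier : Type _ :=
  (q : TangentBundle (𝓡 n) M) → LinearMap.BilinForm ℝ (TangentSpace (𝓡 n) q.proj)

/-- The coordinate expression of a vector field on the tangent bundle. -/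
def TVectorField.inChart (X : TVectorField n M) (e : OpenPartialHomeomorph M (Base n))
    (z : Phase n) : Phase n :=
  mfderiv (𝓡 n).tangent 𝓘(ℝ, Phase n) (coords e) (param e z) (X (param e z))

/-- The coordinate expression of a 1-form on the tangent bundle. -/
def TOneForm.inChart (θ : TOneForm n M) (e : OpenPartialHomeomorph M (Base n))
    (z : Phase n) : Phase n →L[ℝ] ℝ :=
  (θ (param e z)).comp (mfderiv 𝓘(ℝ, Phase n) (𝓡 n).tangent (param e) z)

/-- The component `θᵢ = θ(∂/∂xⁱ)` of a 1-form on the tangent bundle. -/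
def TOneForm.comp (θ : TOneForm n M) (e : OpenPartialHomeomorph M (Base n)) (i : Fin n)
    (z : Phase n) : ℝ :=
  θ.inChart e z (ddx i)

/-- The components `hᵢⱼ` of a tensor field along the tangent bundle projection. -/
def Multiplier.comp (h : Multiplier n M) (e : OpenPartialHomeomorph M (Base n)) (i j : Fin n)
    (z : Phase n) : ℝ :=
  h (param e z) (mfderiv (𝓡 n) (𝓡 n) e.symm z.1 (EuclideanSpace.single i (1 : ℝ)))
    (mfderiv (𝓡 n) (𝓡 n) e.symm z.1 (EuclideanSpace.single j (1 : ℝ)))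

/-- `Γ` is a spray on `M`: a smooth vector field on the slit tangent bundle such that
`τ_* Γ_{(x,y)} = y` and `[Δ, Γ] = Γ`. -/
structure IsSpray (Γ : TVectorField n M) : Prop where
  smooth : ∀ e ∈ IsManifold.maximalAtlas (𝓡 n) ∞ M,
    ContDiffOn ℝ ∞ (Γ.inChart e) (slitDomain Set.univ e)
  second_order : ∀ q : TangentBundle (𝓡 n) M, q.2 ≠ 0 →
    mfderiv (𝓡 n).tangent (𝓡 n)
      (Bundle.TotalSpace.proj : TangentBundle (𝓡 n) M → M) q (Γ q) = q.2
  bracket : ∀ e ∈ IsManifold.maximalAtlas (𝓡 n) ∞ M, ∀ z ∈ slitDomain Set.univ e,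
    VectorField.lieBracket ℝ liouville (Γ.inChart e) z = Γ.inChart e z

/-- The coefficients `Γⁱ` of a spray, `Γ = yⁱ ∂/∂xⁱ - 2 Γⁱ ∂/∂yⁱ`. -/
def sprayCoeff (Γ : TVectorField n M) (e : OpenPartialHomeomorph M (Base n)) (i : Fin n)
    (z : Phase n) : ℝ :=
  -(1 / 2) * (Γ.inChart e z).2 i

/-- `θ` is a (smooth) semi-basic 1-form on `τ⁻¹(U)`: it vanishes on vertical vectors. -/
structure IsSemiBasicOn (U : Set M) (θ : TOneForm n M) : Prop where
  smooth : ∀ e ∈ IsManifold.maximalAtlas (𝓡 n) ∞ M,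
    ContDiffOn ℝ ∞ (θ.inChart e) (slitDomain U e)
  semibasic : ∀ q : TangentBundle (𝓡 n) M, q.proj ∈ U → q.2 ≠ 0 →
    ∀ ξ : TangentSpace (𝓡 n).tangent q,
      mfderiv (𝓡 n).tangent (𝓡 n)
        (Bundle.TotalSpace.proj : TangentBundle (𝓡 n) M → M) q ξ = 0 → θ q ξ = 0

/-- The differential Bucataru–Muzsnay conditions on `τ⁻¹(U)`:
`L_Δ θ = 0`, `d_J θ = 0` and `d_H θ = 0`. -/
structure DifferentialConditionsOn (Γ : TVectorField n M) (U : Set M) (θ : TOneForm n M) :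
    Prop where
  lie : ∀ e ∈ IsManifold.maximalAtlas (𝓡 n) ∞ M, ∀ z ∈ slitDomain U e, ∀ v,
    lieD liouville (θ.inChart e) z v = 0
  dJ : ∀ e ∈ IsManifold.maximalAtlas (𝓡 n) ∞ M, ∀ z ∈ slitDomain U e, ∀ u v,
    extDAlong tangentStructure (θ.inChart e) z u v = 0
  dH : ∀ e ∈ IsManifold.maximalAtlas (𝓡 n) ∞ M, ∀ z ∈ slitDomain U e, ∀ u v,
    extDAlong (horProj (sprayCoeff Γ e)) (θ.inChart e) z u v = 0

/-- `h` is smooth on `τ⁻¹(U)`. -/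
def IsSmoothMultiplierOn (U : Set M) (h : Multiplier n M) : Prop :=
  ∀ e ∈ IsManifold.maximalAtlas (𝓡 n) ∞ M, ∀ i j,
    ContDiffOn ℝ ∞ (h.comp e i j) (slitDomain U e)

/-- The dynamical covariant derivative
`(∇h)ᵢⱼ = Γ(hᵢⱼ) - Γᵏᵢ hₖⱼ - Γᵏⱼ hᵢₖ`. -/
def nabla (Γ : TVectorField n M) (h : Multiplier n M) (e : OpenPartialHomeomorph M (Base n))
    (i j : Fin n) (z : Phase n) : ℝ :=
  fderiv ℝ (h.comp e i j) z (Γ.inChart e z)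
    - ∑ k, gammaCoeff (sprayCoeff Γ e) k i z * h.comp e k j z
    - ∑ k, gammaCoeff (sprayCoeff Γ e) k j z * h.comp e i k z

/-- The Helmholtz conditions on `τ⁻¹(U)`. -/
structure HelmholtzOn (Γ : TVectorField n M) (U : Set M) (h : Multiplier n M) : Prop where
  symm : ∀ e ∈ IsManifold.maximalAtlas (𝓡 n) ∞ M, ∀ z ∈ slitDomain U e, ∀ i j,
    h.comp e j i z = h.comp e i j z
  contract : ∀ e ∈ IsManifold.maximalAtlas (𝓡 n) ∞ M, ∀ z ∈ slitDomain U e, ∀ i,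
    ∑ j, h.comp e i j z * z.2 j = 0
  vertical : ∀ e ∈ IsManifold.maximalAtlas (𝓡 n) ∞ M, ∀ z ∈ slitDomain U e, ∀ i j k,
    V k (h.comp e i j) z = V j (h.comp e i k) z
  nabla_eq_zero : ∀ e ∈ IsManifold.maximalAtlas (𝓡 n) ∞ M, ∀ z ∈ slitDomain U e, ∀ i j,
    nabla Γ h e i j z = 0
  weyl_symm : ∀ e ∈ IsManifold.maximalAtlas (𝓡 n) ∞ M, ∀ z ∈ slitDomain U e, ∀ i j,
    ∑ k, h.comp e i k z * weyl (sprayCoeff Γ e) k j z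
      = ∑ k, h.comp e j k z * weyl (sprayCoeff Γ e) k i z

/-- `hᵢⱼ = Vᵢ(θⱼ)` on `τ⁻¹(U)`. -/
def IsVerticalDerivOn (U : Set M) (θ : TOneForm n M) (h : Multiplier n M) : Prop :=
  ∀ e ∈ IsManifold.maximalAtlas (𝓡 n) ∞ M, ∀ z ∈ slitDomain U e, ∀ i j,
    h.comp e i j z = V i (θ.comp e j) z

end SprayGeometry

end

/-!
Let `θ` be a semi-basic 1-form with `L_Δ θ = 0` and `d_J θ = 0`, put `hᵢⱼ = Vᵢ(θⱼ)`, which is then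
symmetric with `hᵢⱼ yʲ = 0`, and let `ωᵢⱼ = Hᵢ(θⱼ) - Hⱼ(θᵢ)` be the components of `d_H θ`. The
argument rests on two identities. The structure equation `(∇h)ᵢⱼ = yᵏ Vᵢ(ωₖⱼ)`
(`nabla_vertDeriv_eq`) follows from the commutator of `Vᵢ` and `Hₖ` and from homogeneity. The cyclic
sum of `Hᵢ(ωⱼₖ)` is minus the cyclic sum of `Rˡᵢⱼ hₗₖ` (`cyclic_H_horCurl`), and contracting the
latter with `y` leaves the commutator of `h` with the Jacobi endomorphism
(`contract_cyclic_curvature`). This commutator is the same as the one with the Weyl tensor, since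
`h` is symmetric and annihilates `y` (`weyl_symm_iff`).

If `d_H θ = 0`, both identities have a vanishing `ω` side, and the Helmholtz conditions follow
(`helmholtzOn_of_isVerticalDerivOn`).

Conversely, let `h` satisfy the Helmholtz conditions. In a chart over a ball the condition on
`∂hᵢⱼ/∂yᵏ` says that the 1-forms `hᵢⱼ dyⁱ` are closed on the slit fibres. These are simply
connected because `n ≥ 3`, so there is `θⱼ` with `Vᵢ(θⱼ) = hᵢⱼ` (`exists_fiber_primitive_slit`).
From `∇h = 0`, the derivative `Vₖ(ωᵢⱼ)` is symmetric in `k, i` and antisymmetric in `i, j`, hence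
zero: `ω` is a 2-form on the base (`V_horCurl_eq_zero`). Its exterior derivative does not depend on
`y` and has vanishing contraction with `y`, hence is zero (`cyclic_H_horCurl_eq_zero`). Subtracting
a potential of `ω` on the base (`exists_basic_potential`) from `θ` yields `d_H θ = 0`.

The differential conditions are required in all induced coordinates, not only in those of the
chart of the construction. For `d_H θ`, the passage uses that `i_Γ dθ` has an invariant meaning and
equals `yᵏ ωₖⱼ dxʲ` (`extD_spray_eq`, `extD_pullback`), and that `∇h = 0` recovers `ω` from this
contraction (`horCurl_eq_zero_of_contract`).
-/

noncomputable section

namespace SprayGeometry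

variable {n : ℕ}

/-! ### Derivations in induced coordinates -/

section Calculus

variable {F : Type*} [NormedAddCommGroup F] [NormedSpace ℝ F]
  {E : Type*} [NormedAddCommGroup E] [NormedSpace ℝ E] {D : Set E} {z : E}

theorem _root_.ContDiffOn.fderiv_along {f : E → F} {Y : E → E} (hD : IsOpen D)
    (hf : ContDiffOn ℝ ∞ f D) (hY : ContDiffOn ℝ ∞ Y D) :
    ContDiffOn ℝ ∞ (fun z => fderiv ℝ f z (Y z)) D :=
  (((contDiffOn_infty_iff_fderiv_of_isOpen hD).1 hf).2).clm_apply hY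

theorem _root_.ContDiffOn.contDiffAt_of_isOpen {f : E → F} (hD : IsOpen D)
    (hf : ContDiffOn ℝ ∞ f D) (hz : z ∈ D) : ContDiffAt ℝ ∞ f z :=
  hf.contDiffAt (hD.mem_nhds hz)

theorem _root_.ContDiffOn.differentiableAt_of_isOpen {f : E → F} (hD : IsOpen D)
    (hf : ContDiffOn ℝ ∞ f D) (hz : z ∈ D) : DifferentiableAt ℝ f z :=
  (hf.contDiffAt_of_isOpen hD hz).differentiableAt (by simp)

theorem _root_.ContDiffOn.differentiableAt_fderiv {f : E → F} (hD : IsOpen D)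
    (hf : ContDiffOn ℝ ∞ f D) (hz : z ∈ D) : DifferentiableAt ℝ (fderiv ℝ f) z :=
  ((contDiffOn_infty_iff_fderiv_of_isOpen hD).1 hf).2.differentiableAt_of_isOpen hD hz

theorem _root_.Set.EqOn.fderiv_eq_of_isOpen {f g : E → F} (hD : IsOpen D) (h : Set.EqOn f g D)
    (hz : z ∈ D) : fderiv ℝ f z = fderiv ℝ g z :=
  (h.eventuallyEq_of_mem (hD.mem_nhds hz)).fderiv_eq

/-- Symmetry of second derivatives. -/
theorem fderiv_fderiv_comm {f : E → F} (hD : IsOpen D) (hf : ContDiffOn ℝ ∞ f D) (hz : z ∈ D)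
    (u v : E) : fderiv ℝ (fderiv ℝ f) z u v = fderiv ℝ (fderiv ℝ f) z v u :=
  (hf.contDiffAt_of_isOpen hD hz).isSymmSndFDerivAt
    (by simpa using WithTop.coe_le_coe.2 (le_top (a := (2 : ℕ∞)))) u v

theorem fderiv_fderiv_const {f : E → F} (hD : IsOpen D) (hf : ContDiffOn ℝ ∞ f D) (hz : z ∈ D)
    (u v : E) : fderiv ℝ (fun w => fderiv ℝ f w u) z v = fderiv ℝ (fderiv ℝ f) z v u := by
  rw [fderiv_clm_apply (hf.differentiableAt_fderiv hD hz) (differentiableAt_const u)]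
  simp

/-- The derivative of `Y(f)` in the direction `v`, for a vector field `Y` and a constant
field `v`: `v(Y f) = Y(v f) + (v(Y)) f`. -/
theorem fderiv_fderiv_along {f : E → F} {Y : E → E} (hD : IsOpen D)
    (hf : ContDiffOn ℝ ∞ f D) (hY : ContDiffOn ℝ ∞ Y D) (hz : z ∈ D) (v : E) :
    fderiv ℝ (fun w => fderiv ℝ f w (Y w)) z v
      = fderiv ℝ (fun w => fderiv ℝ f w v) z (Y z) + fderiv ℝ f z (fderiv ℝ Y z v) := by
  rw [fderiv_clm_apply (hf.differentiableAt_fderiv hD hz) (hY.differentiableAt_of_isOpen hD hz),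
    fderiv_fderiv_const hD hf hz, fderiv_fderiv_comm hD hf hz]
  simp [add_comm]

theorem fderiv_sum_mul {ι : Type*} [Fintype ι] {f g : ι → E → ℝ}
    (hf : ∀ a, DifferentiableAt ℝ (f a) z) (hg : ∀ a, DifferentiableAt ℝ (g a) z) (v : E) :
    fderiv ℝ (fun w => ∑ a, f a w * g a w) z v
      = ∑ a, (f a z * fderiv ℝ (g a) z v + fderiv ℝ (f a) z v * g a z) := by
  rw [fderiv_fun_sum (fun a _ => (hf a).fun_mul (hg a))]
  simp only [sum_apply]
  refine Finset.sum_congr rfl fun a _ => ?_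
  rw [fderiv_fun_mul (hf a) (hg a)]
  simp [mul_comm]

end Calculus

section Fields

variable {D : Set (Phase n)} {z : Phase n} {G : Fin n → Phase n → ℝ} {f : Phase n → ℝ}

theorem contDiff_fiberCoord (k : Fin n) : ContDiff ℝ ∞ (fun w : Phase n => w.2 k) :=
  (EuclideanSpace.proj k : Base n →L[ℝ] ℝ).contDiff.comp contDiff_snd

theorem differentiableAt_fiberCoord (k : Fin n) :
    DifferentiableAt ℝ (fun w : Phase n => w.2 k) z :=
  (contDiff_fiberCoord k).differentiable (by simp) z

theorem fderiv_fiberCoord (k : Fin n) (v : Phase n) :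
    fderiv ℝ (fun w : Phase n => w.2 k) z v = v.2 k := by
  have := ((EuclideanSpace.proj k : Base n →L[ℝ] ℝ).comp
    (ContinuousLinearMap.snd ℝ (Base n) (Base n))).hasFDerivAt (x := z)
  exact congrArg (· v) this.fderiv

theorem contDiffOn_V (hD : IsOpen D) (hf : ContDiffOn ℝ ∞ f D) (i : Fin n) :
    ContDiffOn ℝ ∞ (V i f) D :=
  hf.fderiv_along hD contDiffOn_const

theorem contDiffOn_gammaCoeff (hD : IsOpen D) (hG : ∀ i, ContDiffOn ℝ ∞ (G i) D) (i j : Fin n) :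
    ContDiffOn ℝ ∞ (gammaCoeff G i j) D :=
  contDiffOn_V hD (hG i) j

theorem contDiffOn_horField (hD : IsOpen D) (hG : ∀ i, ContDiffOn ℝ ∞ (G i) D) (i : Fin n) :
    ContDiffOn ℝ ∞ (horField G i) D :=
  contDiffOn_const.sub
    (ContDiffOn.sum fun j _ => (contDiffOn_gammaCoeff hD hG j i).smul contDiffOn_const)

theorem contDiffOn_H (hD : IsOpen D) (hG : ∀ i, ContDiffOn ℝ ∞ (G i) D)
    (hf : ContDiffOn ℝ ∞ f D) (i : Fin n) : ContDiffOn ℝ ∞ (H G i f) D :=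
  hf.fderiv_along hD (contDiffOn_horField hD hG i)

theorem fderiv_horField (hD : IsOpen D) (hG : ∀ i, ContDiffOn ℝ ∞ (G i) D) (hz : z ∈ D)
    (i : Fin n) (v : Phase n) :
    fderiv ℝ (horField G i) z v = -∑ m, fderiv ℝ (gammaCoeff G m i) z v • ddy m := by
  have h : HasFDerivAt (horField G i)
      (-∑ m, (fderiv ℝ (gammaCoeff G m i) z).smulRight (ddy m)) z :=
    (HasFDerivAt.fun_sum fun m _ =>
      ((contDiffOn_gammaCoeff hD hG m i).differentiableAt_of_isOpen hD hz).hasFDerivAt.smul_const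
        (ddy m)).const_sub (ddx i)
  rw [h.fderiv]
  simp

theorem V_comm (hD : IsOpen D) (hf : ContDiffOn ℝ ∞ f D) (hz : z ∈ D) (i j : Fin n) :
    V i (V j f) z = V j (V i f) z := by
  unfold V
  rw [fderiv_fderiv_const hD hf hz, fderiv_fderiv_const hD hf hz, fderiv_fderiv_comm hD hf hz]

/-- The commutator `[Vᵢ, Hₖ] = -(∂Γᵐₖ/∂yⁱ) Vₘ`. -/
theorem V_H (hD : IsOpen D) (hG : ∀ i, ContDiffOn ℝ ∞ (G i) D) (hf : ContDiffOn ℝ ∞ f D)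
    (hz : z ∈ D) (i k : Fin n) :
    V i (H G k f) z = H G k (V i f) z - ∑ m, V i (gammaCoeff G m k) z * V m f z := by
  have := fderiv_fderiv_along hD hf (contDiffOn_horField hD hG k) hz (ddy i)
  rw [fderiv_horField hD hG hz] at this
  simp only [map_neg, map_sum, map_smul, smul_eq_mul, ← sub_eq_add_neg] at this
  exact this

/-- The commutator `[Hᵢ, Hⱼ] = -Rᵐᵢⱼ Vₘ`. -/
theorem H_H (hD : IsOpen D) (hG : ∀ i, ContDiffOn ℝ ∞ (G i) D) (hf : ContDiffOn ℝ ∞ f D)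
    (hz : z ∈ D) (i j : Fin n) :
    H G i (H G j f) z - H G j (H G i f) z = -∑ m, curvature G m i j z * V m f z := by
  have h1 := fderiv_fderiv_along hD hf (contDiffOn_horField hD hG j) hz (horField G i z)
  have h2 := fderiv_fderiv_along hD hf (contDiffOn_horField hD hG i) hz (horField G j z)
  rw [fderiv_horField hD hG hz, fderiv_fderiv_const hD hf hz] at h1 h2
  have h3 := fderiv_fderiv_comm hD hf hz (horField G i z) (horField G j z)
  simp only [map_neg, map_sum, map_smul, smul_eq_mul] at h1 h2
  change H G i (H G j f) z = _ at h1
  change H G j (H G i f) z = _ at h2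
  rw [h1, h2, h3]
  simp only [curvature, sub_mul, Finset.sum_sub_distrib]
  simp only [H, V]
  ring

theorem curvature_antisymm (l i j : Fin n) : curvature G l j i z = -curvature G l i j z := by
  simp [curvature]

theorem V_eq_of_eqOn (hD : IsOpen D) {g : Phase n → ℝ} (h : Set.EqOn f g D) (hz : z ∈ D)
    (i : Fin n) : V i f z = V i g z := by
  unfold V; rw [h.fderiv_eq_of_isOpen hD hz]

theorem H_eq_of_eqOn (hD : IsOpen D) {g : Phase n → ℝ} (h : Set.EqOn f g D) (hz : z ∈ D)
    (i : Fin n) : H G i f z = H G i g z := by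
  unfold H; rw [h.fderiv_eq_of_isOpen hD hz]

theorem H_sub (hD : IsOpen D) {g : Phase n → ℝ} (hf : ContDiffOn ℝ ∞ f D)
    (hg : ContDiffOn ℝ ∞ g D) (hz : z ∈ D) (i : Fin n) :
    H G i (fun w => f w - g w) z = H G i f z - H G i g z := by
  unfold H
  rw [fderiv_fun_sub (hf.differentiableAt_of_isOpen hD hz) (hg.differentiableAt_of_isOpen hD hz)]
  rfl

theorem V_sub (hD : IsOpen D) {g : Phase n → ℝ} (hf : ContDiffOn ℝ ∞ f D)
    (hg : ContDiffOn ℝ ∞ g D) (hz : z ∈ D) (i : Fin n) :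
    V i (fun w => f w - g w) z = V i f z - V i g z := by
  unfold V
  rw [fderiv_fun_sub (hf.differentiableAt_of_isOpen hD hz) (hg.differentiableAt_of_isOpen hD hz)]
  rfl

theorem horField_snd (i k : Fin n) : (horField G i z).2 k = -gammaCoeff G k i z := by
  simp [horField, ddx, ddy, Prod.snd_sum, Pi.single_apply]

theorem horField_fst (i : Fin n) : (horField G i z).1 = EuclideanSpace.single i 1 := by
  simp [horField, ddx, ddy, Prod.fst_sum]

/-- `Vᵢ(fₖ yᵏ) = fᵢ + yᵏ Vᵢ(fₖ)`. -/
theorem V_sum_fiberCoord_mul {g : Fin n → Phase n → ℝ} (hg : ∀ k, DifferentiableAt ℝ (g k) z)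
    (i : Fin n) :
    V i (fun w => ∑ k, w.2 k * g k w) z = g i z + ∑ k, z.2 k * V i (g k) z := by
  unfold V
  rw [fderiv_sum_mul (fun k => differentiableAt_fiberCoord k) hg, Finset.sum_add_distrib, add_comm]
  simp [fderiv_fiberCoord, ddy]

/-- `Hᵢ(fₖ yᵏ) = -Γᵏᵢ fₖ + yᵏ Hᵢ(fₖ)`. -/
theorem H_sum_fiberCoord_mul {g : Fin n → Phase n → ℝ} (hg : ∀ k, DifferentiableAt ℝ (g k) z)
    (i : Fin n) :
    H G i (fun w => ∑ k, w.2 k * g k w) z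
      = -(∑ k, gammaCoeff G k i z * g k z) + ∑ k, z.2 k * H G i (g k) z := by
  unfold H
  rw [fderiv_sum_mul (fun k => differentiableAt_fiberCoord k) hg, Finset.sum_add_distrib, add_comm]
  simp [fderiv_fiberCoord, horField_snd]

end Fields

/-! ### The horizontal differential of a semi-basic 1-form -/

/-- The components `Hᵢ(θⱼ) - Hⱼ(θᵢ)` of `d_H θ`, for a semi-basic 1-form `θ = θᵢ dxⁱ`. -/
def horCurl (G θ : Fin n → Phase n → ℝ) (i j : Fin n) (z : Phase n) : ℝ :=
  H G i (θ j) z - H G j (θ i) z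

theorem horCurl_antisymm (G θ : Fin n → Phase n → ℝ) (i j : Fin n) (z : Phase n) :
    horCurl G θ j i z = -horCurl G θ i j z := by
  simp [horCurl]

section

variable {D : Set (Phase n)} {z : Phase n} {G θ : Fin n → Phase n → ℝ}

theorem contDiffOn_horCurl (hD : IsOpen D) (hG : ∀ i, ContDiffOn ℝ ∞ (G i) D)
    (hθ : ∀ i, ContDiffOn ℝ ∞ (θ i) D) (i j : Fin n) : ContDiffOn ℝ ∞ (horCurl G θ i j) D :=
  (contDiffOn_H hD hG (hθ j) i).sub (contDiffOn_H hD hG (hθ i) j)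

/-- For spray coefficients homogeneous of degree two, `Γⁱⱼ` is homogeneous of degree one. -/
theorem sum_fiberCoord_mul_V_gammaCoeff (hD : IsOpen D) (hG : ∀ i, ContDiffOn ℝ ∞ (G i) D)
    (hE : ∀ z ∈ D, ∀ i, ∑ k, z.2 k * V k (G i) z = 2 * G i z) (hz : z ∈ D) (m i : Fin n) :
    ∑ k, z.2 k * V i (gammaCoeff G m k) z = gammaCoeff G m i z := by
  have h1 := V_sum_fiberCoord_mul (z := z) (g := fun k => V k (G m))
    (fun k => (contDiffOn_V hD (hG m) k).differentiableAt_of_isOpen hD hz) i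
  have h2 : V i (fun w => ∑ k, w.2 k * V k (G m) w) z = V i (fun w => 2 * G m w) z :=
    V_eq_of_eqOn hD (fun w hw => hE w hw m) hz i
  have h3 : V i (fun w => 2 * G m w) z = 2 * V i (G m) z := by
    unfold V
    rw [fderiv_const_mul ((hG m).differentiableAt_of_isOpen hD hz)]
    rfl
  change ∑ k, z.2 k * V i (V k (G m)) z = V i (G m) z
  linarith

/-- A spray is horizontal: `Γ = yᵏ Hₖ`. -/
theorem fderiv_spray_eq_sum_H (hE : ∀ z ∈ D, ∀ i, ∑ k, z.2 k * V k (G i) z = 2 * G i z)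
    (hz : z ∈ D) {S : Phase n} (h1 : S.1 = z.2) (h2 : ∀ i, S.2 i = -2 * G i z)
    (f : Phase n → ℝ) : fderiv ℝ f z S = ∑ k, z.2 k * H G k f z := by
  have : S = ∑ k, z.2 k • horField G k z := by
    refine Prod.ext ?_ ?_
    · ext i
      simp [Prod.fst_sum, horField_fst, h1, Pi.single_apply]
    · ext i
      simp only [h2, Prod.snd_sum, Prod.smul_snd, WithLp.ofLp_sum, WithLp.ofLp_smul,
        Finset.sum_apply, Pi.smul_apply, horField_snd, smul_eq_mul, mul_neg,
        Finset.sum_neg_distrib, neg_mul, neg_inj]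
      exact (hE z hz i).symm
  rw [this, map_sum]
  simp [H]

/-- The structure equation of the theory: if `θ` is homogeneous of degree zero and `d_J θ = 0`,
then the Hessian-like tensor `hᵢⱼ = Vᵢ(θⱼ)` satisfies `(∇h)ᵢⱼ = yᵏ Vᵢ((d_H θ)ₖⱼ)`. -/
theorem nabla_vertDeriv_eq (hD : IsOpen D) (hG : ∀ i, ContDiffOn ℝ ∞ (G i) D)
    (hE : ∀ z ∈ D, ∀ i, ∑ k, z.2 k * V k (G i) z = 2 * G i z)
    (hθ : ∀ i, ContDiffOn ℝ ∞ (θ i) D)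
    (hS : ∀ z ∈ D, ∀ i j, V i (θ j) z = V j (θ i) z)
    (hZ : ∀ z ∈ D, ∀ j, ∑ k, z.2 k * V k (θ j) z = 0) (hz : z ∈ D) (i j : Fin n) :
    ∑ k, z.2 k * V i (horCurl G θ k j) z
      = (∑ k, z.2 k * H G k (V i (θ j)) z)
        - (∑ k, gammaCoeff G k i z * V k (θ j) z) - ∑ k, gammaCoeff G k j z * V i (θ k) z := by
  have hV : ∀ k, V i (horCurl G θ k j) z
      = (H G k (V i (θ j)) z - ∑ m, V i (gammaCoeff G m k) z * V m (θ j) z)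
        - (H G j (V i (θ k)) z - ∑ m, V i (gammaCoeff G m j) z * V m (θ k) z) := fun k => by
    rw [← V_H hD hG (hθ j) hz, ← V_H hD hG (hθ k) hz]
    exact V_sub hD (contDiffOn_H hD hG (hθ j) k) (contDiffOn_H hD hG (hθ k) j) hz i
  -- By homogeneity, `yᵏ ∂Γᵐₖ/∂yⁱ = Γᵐᵢ`.
  have h1 : ∑ k, z.2 k * ∑ m, V i (gammaCoeff G m k) z * V m (θ j) z
      = ∑ m, gammaCoeff G m i z * V m (θ j) z := by
    simp only [Finset.mul_sum]
    rw [Finset.sum_comm]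
    refine Finset.sum_congr rfl fun m _ => ?_
    rw [← sum_fiberCoord_mul_V_gammaCoeff hD hG hE hz m i, Finset.sum_mul]
    exact Finset.sum_congr rfl fun k _ => by ring
  have h2 : ∑ k, z.2 k * ∑ m, V i (gammaCoeff G m j) z * V m (θ k) z = 0 := by
    simp only [Finset.mul_sum]
    rw [Finset.sum_comm]
    refine Finset.sum_eq_zero fun m _ => ?_
    have : ∑ k, z.2 k * (V i (gammaCoeff G m j) z * V m (θ k) z)
        = V i (gammaCoeff G m j) z * ∑ k, z.2 k * V k (θ m) z := by
      rw [Finset.mul_sum]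
      exact Finset.sum_congr rfl fun k _ => by rw [hS z hz m k]; ring
    rw [this, hZ z hz, mul_zero]
  -- This is `Hⱼ` applied to `yᵏ Vᵢ(θₖ) = 0`.
  have h3 : ∑ k, z.2 k * H G j (V i (θ k)) z = ∑ k, gammaCoeff G k j z * V i (θ k) z := by
    have h4 := H_sum_fiberCoord_mul (G := G) (z := z) (g := fun k => V i (θ k))
      (fun k => (contDiffOn_V hD (hθ k) i).differentiableAt_of_isOpen hD hz) j
    have h5 : H G j (fun w => ∑ k, w.2 k * V i (θ k) w) z = H G j (fun _ => 0) z := by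
      refine H_eq_of_eqOn hD (fun w hw => ?_) hz j
      rw [← hZ w hw i]
      exact Finset.sum_congr rfl fun k _ => by rw [hS w hw i k]
    have h6 : H G j (fun _ => 0) z = 0 := by simp [H]
    linarith
  have h7 : ∑ k, z.2 k * V i (horCurl G θ k j) z
      = ((∑ k, z.2 k * H G k (V i (θ j)) z)
          - ∑ k, z.2 k * ∑ m, V i (gammaCoeff G m k) z * V m (θ j) z)
        - ((∑ k, z.2 k * H G j (V i (θ k)) z)
          - ∑ k, z.2 k * ∑ m, V i (gammaCoeff G m j) z * V m (θ k) z) := by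
    simp only [← Finset.sum_sub_distrib]
    exact Finset.sum_congr rfl fun k _ => by rw [hV]; ring
  rw [h7, h1, h2, h3]
  ring

/-- If `yᵏ Vᵢ(ωₖⱼ) = 0` for `ω = d_H θ`, then `ω` is recovered from its contraction with `y`. -/
theorem V_contract_horCurl (hD : IsOpen D) (hG : ∀ i, ContDiffOn ℝ ∞ (G i) D)
    (hθ : ∀ i, ContDiffOn ℝ ∞ (θ i) D)
    (hN : ∀ z ∈ D, ∀ i j, ∑ k, z.2 k * V i (horCurl G θ k j) z = 0) (hz : z ∈ D) (i j : Fin n) :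
    V i (fun w => ∑ k, w.2 k * horCurl G θ k j w) z = horCurl G θ i j z := by
  rw [V_sum_fiberCoord_mul
    fun k => (contDiffOn_horCurl hD hG hθ k j).differentiableAt_of_isOpen hD hz, hN z hz, add_zero]

theorem contDiffOn_contract_horCurl (hD : IsOpen D) (hG : ∀ i, ContDiffOn ℝ ∞ (G i) D)
    (hθ : ∀ i, ContDiffOn ℝ ∞ (θ i) D) (j : Fin n) :
    ContDiffOn ℝ ∞ (fun w => ∑ k, w.2 k * horCurl G θ k j w) D :=
  ContDiffOn.sum fun k _ =>
    (contDiff_fiberCoord k).contDiffOn.mul (contDiffOn_horCurl hD hG hθ k j)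

/-- If `yᵏ Vᵢ(ωₖⱼ) = 0` for `ω = d_H θ`, then `ω` vanishes as soon as its contraction with `y`
does. -/
theorem horCurl_eq_zero_of_contract (hD : IsOpen D) (hG : ∀ i, ContDiffOn ℝ ∞ (G i) D)
    (hθ : ∀ i, ContDiffOn ℝ ∞ (θ i) D)
    (hN : ∀ z ∈ D, ∀ i j, ∑ k, z.2 k * V i (horCurl G θ k j) z = 0)
    (h0 : ∀ z ∈ D, ∀ j, ∑ k, z.2 k * horCurl G θ k j z = 0) (hz : z ∈ D) (i j : Fin n) :
    horCurl G θ i j z = 0 := by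
  rw [← V_contract_horCurl hD hG hθ hN hz,
    V_eq_of_eqOn hD (g := fun _ => 0) (fun w hw => h0 w hw j) hz]
  simp [V]

/-- If `yᵏ Vᵢ(ωₖⱼ) = 0` for `ω = d_H θ`, then `ω` is basic: its components do not depend on `y`.
Indeed `Vₖ(ωᵢⱼ)` is symmetric in its first two and antisymmetric in its last two indices. -/
theorem V_horCurl_eq_zero (hD : IsOpen D) (hG : ∀ i, ContDiffOn ℝ ∞ (G i) D)
    (hθ : ∀ i, ContDiffOn ℝ ∞ (θ i) D)
    (hN : ∀ z ∈ D, ∀ i j, ∑ k, z.2 k * V i (horCurl G θ k j) z = 0) (hz : z ∈ D)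
    (k i j : Fin n) : V k (horCurl G θ i j) z = 0 := by
  have hsym : ∀ k i j, V k (horCurl G θ i j) z = V i (horCurl G θ k j) z := fun k i j => by
    have e : ∀ i j, Set.EqOn (horCurl G θ i j) (V i fun w => ∑ k, w.2 k * horCurl G θ k j w) D :=
      fun i j w hw => (V_contract_horCurl hD hG hθ hN hw i j).symm
    rw [V_eq_of_eqOn hD (e i j) hz, V_eq_of_eqOn hD (e k j) hz]
    exact V_comm hD (contDiffOn_contract_horCurl hD hG hθ j) hz k i
  have hanti : ∀ k i j, V k (horCurl G θ i j) z = -V k (horCurl G θ j i) z := fun k i j => by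
    have : horCurl G θ i j = fun w => -horCurl G θ j i w :=
      funext fun w => horCurl_antisymm G θ j i w
    unfold V
    rw [this, fderiv_fun_neg]
    rfl
  have a1 := hsym k i j
  have a2 := hanti i k j
  have a3 := hsym i j k
  have a4 := hanti j i k
  have a5 := hsym j k i
  have a6 := hanti k j i
  linarith

/-- The cyclic sum of `Hᵢ((d_H θ)ⱼₖ)`: the identity `d_H d_H θ = d_R θ`, up to sign. -/
theorem cyclic_H_horCurl (hD : IsOpen D) (hG : ∀ i, ContDiffOn ℝ ∞ (G i) D)
    (hθ : ∀ i, ContDiffOn ℝ ∞ (θ i) D) (hz : z ∈ D) (i j k : Fin n) :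
    H G i (horCurl G θ j k) z + H G j (horCurl G θ k i) z + H G k (horCurl G θ i j) z
      = -((∑ l, curvature G l i j z * V l (θ k) z) + (∑ l, curvature G l j k z * V l (θ i) z)
        + ∑ l, curvature G l k i z * V l (θ j) z) := by
  have h : ∀ a b c, H G a (horCurl G θ b c) z
      = H G a (H G b (θ c)) z - H G a (H G c (θ b)) z := fun a b c =>
    H_sub hD (contDiffOn_H hD hG (hθ c) b) (contDiffOn_H hD hG (hθ b) c) hz a
  have h1 := H_H hD hG (hθ k) hz i j
  have h2 := H_H hD hG (hθ i) hz j k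
  have h3 := H_H hD hG (hθ j) hz k i
  rw [h, h, h]
  linarith

/-- Contracting the cyclic sum of `Rˡᵢⱼ hₗₖ` with `yᵏ` leaves the commutator of `h` with the
Jacobi endomorphism, because `hₗₖ yᵏ = 0`. -/
theorem contract_cyclic_curvature {h : Fin n → Fin n → ℝ} (hy : ∀ l, ∑ k, z.2 k * h l k = 0)
    (i j : Fin n) :
    ∑ k, z.2 k * ((∑ l, curvature G l i j z * h l k) + (∑ l, curvature G l j k z * h l i)
        + ∑ l, curvature G l k i z * h l j)
      = (∑ l, jacobi G l j z * h l i) - ∑ l, jacobi G l i z * h l j := by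
  have h1 : ∑ k, z.2 k * ∑ l, curvature G l i j z * h l k = 0 := by
    simp only [Finset.mul_sum]
    rw [Finset.sum_comm]
    refine Finset.sum_eq_zero fun l _ => ?_
    have := congrArg (curvature G l i j z * ·) (hy l)
    simp only [Finset.mul_sum, mul_zero] at this
    rw [← this]
    exact Finset.sum_congr rfl fun k _ => by ring
  have h2 : ∀ a b, ∑ k, z.2 k * ∑ l, curvature G l a k z * h l b
      = ∑ l, jacobi G l a z * h l b := fun a b => by
    simp only [Finset.mul_sum, jacobi, Finset.sum_mul]
    rw [Finset.sum_comm]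
    exact Finset.sum_congr rfl fun l _ => Finset.sum_congr rfl fun k _ => by ring
  have h3 : ∀ k, ∑ l, curvature G l k i z * h l j = -∑ l, curvature G l i k z * h l j := fun k => by
    rw [← Finset.sum_neg_distrib]
    exact Finset.sum_congr rfl fun l _ => by rw [curvature_antisymm]; ring
  simp only [mul_add, Finset.sum_add_distrib, h1, h2, h3, mul_neg, Finset.sum_neg_distrib]
  ring

/-- For symmetric `h` with `hᵢⱼ yʲ = 0`, the Weyl tensor and the Jacobi endomorphism have the same
commutator with `h`, as they differ by a multiple of the identity and a multiple of `y`. -/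
theorem sum_mul_weyl {h : Fin n → Fin n → ℝ} (hy : ∀ l, ∑ k, z.2 k * h l k = 0) (i j : Fin n) :
    ∑ k, h i k * weyl G k j z
      = (∑ k, h i k * jacobi G k j z) - (∑ m, jacobi G m m z) / ((n : ℝ) - 1) * h i j := by
  have : ∀ k, h i k * weyl G k j z = h i k * jacobi G k j z
      - (if k = j then (∑ m, jacobi G m m z) / ((n : ℝ) - 1) * h i k else 0)
      - (1 / ((n : ℝ) + 1)) * (∑ m, V m (jacobiTraceAdjusted G m j) z) * (z.2 k * h i k) := by
    intro k
    unfold weyl jacobiTraceAdjusted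
    split_ifs <;> ring
  simp only [this, Finset.sum_sub_distrib, ← Finset.mul_sum, hy, mul_zero, sub_zero]
  simp

theorem weyl_symm_iff {h : Fin n → Fin n → ℝ} (hs : ∀ i j, h j i = h i j)
    (hy : ∀ l, ∑ k, z.2 k * h l k = 0) (i j : Fin n) :
    (∑ k, h i k * weyl G k j z = ∑ k, h j k * weyl G k i z) ↔
      (∑ l, jacobi G l j z * h l i) - ∑ l, jacobi G l i z * h l j = 0 := by
  have e : ∀ a b, ∑ k, h a k * jacobi G k b z = ∑ l, jacobi G l b z * h l a := fun a b =>
    Finset.sum_congr rfl fun k _ => by rw [hs a k]; ring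
  rw [sum_mul_weyl hy, sum_mul_weyl hy, e, e, hs i j, sub_left_inj, sub_eq_zero]

/-- The curvature obstruction vanishes: if `d_H θ` is basic and `hᵢⱼ = Vᵢ(θⱼ)` commutes with the
Jacobi endomorphism, then `d_H θ` is closed. The cyclic sum is a function of `x` alone whose
contraction with `y` vanishes identically. -/
theorem cyclic_H_horCurl_eq_zero (hD : IsOpen D) (hG : ∀ i, ContDiffOn ℝ ∞ (G i) D)
    (hθ : ∀ i, ContDiffOn ℝ ∞ (θ i) D)
    (hS : ∀ z ∈ D, ∀ i j, V i (θ j) z = V j (θ i) z)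
    (hZ : ∀ z ∈ D, ∀ j, ∑ k, z.2 k * V k (θ j) z = 0)
    (hω : ∀ z ∈ D, ∀ k i j, V k (horCurl G θ i j) z = 0)
    (hR : ∀ z ∈ D, ∀ i j,
      (∑ l, jacobi G l j z * V l (θ i) z) - ∑ l, jacobi G l i z * V l (θ j) z = 0)
    (hz : z ∈ D) (i j k : Fin n) :
    H G i (horCurl G θ j k) z + H G j (horCurl G θ k i) z + H G k (horCurl G θ i j) z = 0 := by
  let C : Fin n → Phase n → ℝ := fun k w =>
    H G i (horCurl G θ j k) w + H G j (horCurl G θ k i) w + H G k (horCurl G θ i j) w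
  have hsm : ∀ a b c, ContDiffOn ℝ ∞ (H G a (horCurl G θ b c)) D := fun a b c =>
    contDiffOn_H hD hG (contDiffOn_horCurl hD hG hθ b c) a
  have hd : ∀ a b c, ∀ w ∈ D, DifferentiableAt ℝ (H G a (horCurl G θ b c)) w :=
    fun a b c w hw => (hsm a b c).differentiableAt_of_isOpen hD hw
  have hVH : ∀ m a b c, V m (H G a (horCurl G θ b c)) z = 0 := fun m a b c => by
    rw [V_H hD hG (contDiffOn_horCurl hD hG hθ b c) hz,
      H_eq_of_eqOn hD (g := fun _ => 0) (fun w hw => hω w hw m b c) hz]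
    simp [H, hω z hz]
  have hVC : ∀ m k, V m (C k) z = 0 := fun m k => by
    have h1 := hVH m i j k
    have h2 := hVH m j k i
    have h3 := hVH m k i j
    unfold V at h1 h2 h3 ⊢
    rw [fderiv_fun_add ((hd i j k z hz).fun_add (hd j k i z hz)) (hd k i j z hz),
      fderiv_fun_add (hd i j k z hz) (hd j k i z hz)]
    simp [h1, h2, h3]
  have hC0 : ∀ w ∈ D, ∑ k, w.2 k * C k w = 0 := fun w hw => by
    have e : ∀ k, C k w = -((∑ l, curvature G l i j w * V l (θ k) w)
        + (∑ l, curvature G l j k w * V l (θ i) w) + ∑ l, curvature G l k i w * V l (θ j) w) :=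
      fun k => cyclic_H_horCurl hD hG hθ hw i j k
    have hy : ∀ l, ∑ k, w.2 k * V l (θ k) w = 0 := fun l => by
      rw [← hZ w hw l]
      exact Finset.sum_congr rfl fun k _ => by rw [hS w hw l k]
    simp only [e, mul_neg, Finset.sum_neg_distrib]
    rw [contract_cyclic_curvature (h := fun l k => V l (θ k) w) hy, hR w hw, neg_zero]
  -- Differentiate `yᵏ Cₖ = 0` along the fibre: only the term `Cₖ` survives.
  have h1 := V_sum_fiberCoord_mul (z := z) (g := C)
    (fun k => ((hd i j k z hz).fun_add (hd j k i z hz)).fun_add (hd k i j z hz)) k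
  rw [V_eq_of_eqOn hD (g := fun _ => 0) (fun w hw => hC0 w hw) hz] at h1
  simp only [hVC, mul_zero, Finset.sum_const_zero, add_zero] at h1
  rw [show V k (fun _ => (0 : ℝ)) z = 0 by simp [V]] at h1
  exact h1.symm

end

/-! ### Smoothness of parametric integrals -/

section ParametricIntegral

theorem isOpen_forall_mem_Icc {E : Type*} [TopologicalSpace E] {Ω : Set (E × ℝ)} (hΩ : IsOpen Ω) :
    IsOpen {z : E | ∀ t ∈ Set.Icc (0 : ℝ) 1, (z, t) ∈ Ω} := by
  refine isOpen_iff_mem_nhds.2 fun z hz => ?_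
  obtain ⟨U, V, hU, -, hzU, hV, hUV⟩ := generalized_tube_lemma (isCompact_singleton (x := z))
    (isCompact_Icc (a := (0 : ℝ)) (b := 1)) hΩ (by rintro ⟨w, t⟩ ⟨rfl, ht⟩; exact hz t ht)
  exact Filter.mem_of_superset (hU.mem_nhds (hzU rfl)) fun w hw t ht => hUV ⟨hw, hV ht⟩

theorem continuousOn_slice {E F : Type*} [TopologicalSpace E] [TopologicalSpace F]
    {Ω : Set (E × ℝ)} {g : E × ℝ → F} {z : E} (hg : ContinuousOn g Ω)
    (hz : ∀ t ∈ Set.Icc (0 : ℝ) 1, (z, t) ∈ Ω) :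
    ContinuousOn (fun t => g (z, t)) (Set.Icc 0 1) :=
  hg.comp (by fun_prop) hz

theorem intervalIntegrable_slice {E F : Type*} [TopologicalSpace E] [NormedAddCommGroup F]
    {Ω : Set (E × ℝ)} {g : E × ℝ → F} {z : E} (hg : ContinuousOn g Ω)
    (hz : ∀ t ∈ Set.Icc (0 : ℝ) 1, (z, t) ∈ Ω) :
    IntervalIntegrable (fun t => g (z, t)) MeasureTheory.volume 0 1 :=
  (continuousOn_slice hg hz).intervalIntegrable_of_Icc zero_le_one

universe u

variable {E F : Type u} [NormedAddCommGroup E] [NormedSpace ℝ E] [NormedAddCommGroup F]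
  [NormedSpace ℝ F] {Ω : Set (E × ℝ)} {g : E × ℝ → F} {z : E}

theorem hasFDerivAt_slice (hΩ : IsOpen Ω) (hg : ContDiffOn ℝ ∞ g Ω) {t : ℝ} (h : (z, t) ∈ Ω) :
    HasFDerivAt (fun w => g (w, t))
      ((fderiv ℝ g (z, t)).comp (ContinuousLinearMap.inl ℝ E ℝ)) z :=
  (hg.differentiableAt_of_isOpen hΩ h).hasFDerivAt.comp z (hasFDerivAt_prodMk_left z t)

theorem contDiffOn_fderiv_slice (hΩ : IsOpen Ω) (hg : ContDiffOn ℝ ∞ g Ω) :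
    ContDiffOn ℝ ∞ (fun p => (fderiv ℝ g p).comp (ContinuousLinearMap.inl ℝ E ℝ)) Ω :=
  ((contDiffOn_infty_iff_fderiv_of_isOpen hΩ).1 hg).2.clm_comp contDiffOn_const

/-- Differentiation under the integral sign, for a smooth integrand on a compact interval. -/
theorem hasFDerivAt_integral_of_contDiffOn (hΩ : IsOpen Ω) (hg : ContDiffOn ℝ ∞ g Ω)
    (hz : ∀ t ∈ Set.Icc (0 : ℝ) 1, (z, t) ∈ Ω) :
    HasFDerivAt (fun w => ∫ t in (0 : ℝ)..1, g (w, t))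
      (∫ t in (0 : ℝ)..1, (fderiv ℝ g (z, t)).comp (ContinuousLinearMap.inl ℝ E ℝ)) z := by
  set g' : E × ℝ → E →L[ℝ] F :=
    fun p => (fderiv ℝ g p).comp (ContinuousLinearMap.inl ℝ E ℝ) with hg'
  have hc : ContinuousOn g' Ω := (contDiffOn_fderiv_slice hΩ hg).continuousOn
  obtain ⟨C, hC⟩ := isCompact_Icc.exists_bound_of_continuousOn (continuousOn_slice hc hz)
  have hO : IsOpen (Ω ∩ g' ⁻¹' Metric.ball 0 (C + 1)) :=
    hc.isOpen_inter_preimage hΩ Metric.isOpen_ball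
  have hs := isOpen_forall_mem_Icc hO
  have hzs : z ∈ {w : E | ∀ t ∈ Set.Icc (0 : ℝ) 1, (w, t) ∈ Ω ∩ g' ⁻¹' Metric.ball 0 (C + 1)} :=
    fun t ht => ⟨hz t ht, by
      have := hC t ht
      simp only [Set.mem_preimage, mem_ball_zero_iff]
      linarith⟩
  have hI : Set.uIoc (0 : ℝ) 1 ⊆ Set.Icc 0 1 := by
    rw [Set.uIoc_of_le zero_le_one]
    exact Set.Ioc_subset_Icc_self
  refine intervalIntegral.hasFDerivAt_integral_of_dominated_of_fderiv_le (𝕜 := ℝ)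
    (bound := fun _ => C + 1) (F' := fun w t => g' (w, t)) (hs.mem_nhds hzs) ?_
    (intervalIntegrable_slice hg.continuousOn hz) ?_ ?_ (by simp) ?_
  · filter_upwards [hs.mem_nhds hzs] with w hw
    exact ((continuousOn_slice hg.continuousOn fun t ht => (hw t ht).1).mono
      hI).aestronglyMeasurable measurableSet_uIoc
  · exact ((continuousOn_slice hc hz).mono hI).aestronglyMeasurable measurableSet_uIoc
  · refine Filter.Eventually.of_forall fun t ht w hw => ?_
    have := (hw t (hI ht)).2
    simp only [Set.mem_preimage, mem_ball_zero_iff] at this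
    exact this.le
  · exact Filter.Eventually.of_forall fun t ht w hw => hasFDerivAt_slice hΩ hg (hw t (hI ht)).1

theorem contDiffOn_integral_of_contDiffOn (hΩ : IsOpen Ω) (hg : ContDiffOn ℝ ∞ g Ω) :
    ContDiffOn ℝ ∞ (fun z => ∫ t in (0 : ℝ)..1, g (z, t))
      {z | ∀ t ∈ Set.Icc (0 : ℝ) 1, (z, t) ∈ Ω} := by
  refine contDiffOn_infty.2 fun m => ?_
  induction m generalizing F with
  | zero =>
    rw [Nat.cast_zero, contDiffOn_zero]
    exact fun z hz => (hasFDerivAt_integral_of_contDiffOn hΩ hg hz).continuousAt.continuousWithinAt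
  | succ m ih =>
    rw [Nat.cast_succ, contDiffOn_succ_iff_fderiv_of_isOpen (isOpen_forall_mem_Icc hΩ)]
    refine ⟨fun z hz => (hasFDerivAt_integral_of_contDiffOn hΩ hg
      hz).differentiableAt.differentiableWithinAt, by simp, ?_⟩
    exact (ih (contDiffOn_fderiv_slice hΩ hg)).congr fun z hz =>
      (hasFDerivAt_integral_of_contDiffOn hΩ hg hz).fderiv

end ParametricIntegral

/-! ### Homotopy formulas for closed 1-forms and closed 2-forms -/

section Homotopy

variable {P E : Type} [NormedAddCommGroup P] [NormedSpace ℝ P] [NormedAddCommGroup E]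
  [NormedSpace ℝ E]

/-- The Poincaré lemma with parameters: a family of closed 1-forms on the fibres of `O` has a
smooth family of primitives on the points that the segment from the centre `a` joins within `O`. -/
theorem exists_fiber_primitive_of_starShaped {O : Set (P × E)} (hO : IsOpen O)
    {η : P × E → E →L[ℝ] ℝ} (hη : ContDiffOn ℝ ∞ η O)
    (hc : ∀ z ∈ O, ∀ v w, fderiv ℝ η z (0, v) w = fderiv ℝ η z (0, w) v) (a : E) :
    ∃ f : P × E → ℝ,
      IsOpen {z : P × E | ∀ t ∈ Set.Icc (0 : ℝ) 1, (z.1, a + t • (z.2 - a)) ∈ O} ∧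
      ContDiffOn ℝ ∞ f {z | ∀ t ∈ Set.Icc (0 : ℝ) 1, (z.1, a + t • (z.2 - a)) ∈ O} ∧
      ∀ z : P × E, (∀ t ∈ Set.Icc (0 : ℝ) 1, (z.1, a + t • (z.2 - a)) ∈ O) →
        ∀ v, fderiv ℝ f z (0, v) = η z v := by
  let γ : (P × E) × ℝ → P × E := fun q => (q.1.1, a + q.2 • (q.1.2 - a))
  have hγ : ContDiff ℝ ∞ γ := by fun_prop
  let g : (P × E) × ℝ → ℝ := fun q => η (γ q) (q.1.2 - a)
  have hΩ : IsOpen (γ ⁻¹' O) := hO.preimage hγ.continuous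
  have hηγ : ContDiffOn ℝ ∞ (fun q => η (γ q)) (γ ⁻¹' O) :=
    hη.comp hγ.contDiffOn (Set.mapsTo_preimage γ O)
  have hg : ContDiffOn ℝ ∞ g (γ ⁻¹' O) := hηγ.clm_apply (by fun_prop)
  refine ⟨fun z => ∫ t in (0 : ℝ)..1, g (z, t), isOpen_forall_mem_Icc hΩ,
    contDiffOn_integral_of_contDiffOn hΩ hg, fun z hz v => ?_⟩
  have hI : ∀ t ∈ Set.Icc (0 : ℝ) 1, (z, t) ∈ γ ⁻¹' O := hz
  rw [(hasFDerivAt_integral_of_contDiffOn hΩ hg hI).fderiv,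
    ContinuousLinearMap.intervalIntegral_apply
      (intervalIntegrable_slice (contDiffOn_fderiv_slice hΩ hg).continuousOn hI)]
  -- The integrand is the `t`-derivative of `t η(x, a + t (y - a)) v`, since `η` is closed.
  have hderiv : ∀ t ∈ Set.uIcc (0 : ℝ) 1, HasDerivAt (fun t => t * η (γ (z, t)) v)
      ((fderiv ℝ g (z, t)).comp (ContinuousLinearMap.inl ℝ (P × E) ℝ) (0, v)) t := by
    intro t ht
    rw [Set.uIcc_of_le zero_le_one] at ht
    have hηt : HasFDerivAt η (fderiv ℝ η (γ (z, t))) (γ (z, t)) :=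
      (hη.differentiableAt_of_isOpen hO (hz t ht)).hasFDerivAt
    have h1 : HasDerivAt (fun t : ℝ => γ (z, t)) (0, z.2 - a) t :=
      (hasDerivAt_const t z.1).prodMk
        ((((hasDerivAt_id t).smul_const (z.2 - a)).const_add a).congr_deriv (one_smul _ _))
    have h2 : HasDerivAt (fun t => η (γ (z, t))) (fderiv ℝ η (γ (z, t)) (0, z.2 - a)) t :=
      hηt.comp_hasDerivAt t h1
    have h2' : HasDerivAt (fun t => η (γ (z, t)) v) (fderiv ℝ η (γ (z, t)) (0, z.2 - a) v) t :=
      (h2.clm_apply (hasDerivAt_const t v)).congr_deriv (by simp)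
    have h3 : HasFDerivAt (fun w : P × E => γ (w, t))
        ((ContinuousLinearMap.fst ℝ P E).prod (t • ContinuousLinearMap.snd ℝ P E)) z :=
      hasFDerivAt_fst.prodMk (((hasFDerivAt_snd.sub_const a).const_smul t).const_add a)
    have h4 : HasFDerivAt (fun w : P × E => η (γ (w, t))) _ z :=
      HasFDerivAt.comp (g := η) (f := fun w => γ (w, t)) z hηt h3
    have h5 := h4.clm_apply (hasFDerivAt_snd.sub_const a)
    rw [(hasFDerivAt_slice hΩ hg (hI t ht)).unique h5]
    refine ((hasDerivAt_id' t).fun_mul h2').congr_deriv ?_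
    have h6 := hc _ (hz t ht) (z.2 - a) (t • v)
    simp only [map_smul, smul_eq_mul] at h6
    simp only [γ, ContinuousLinearMap.comp_apply,
      add_apply, ContinuousLinearMap.flip_apply,
      ContinuousLinearMap.prod_apply, smul_apply,
      ContinuousLinearMap.coe_fst', ContinuousLinearMap.coe_snd', ← h6, one_mul]
  rw [intervalIntegral.integral_eq_sub_of_hasDerivAt hderiv]
  · simp [γ]
  · exact (continuousOn_slice (((contDiffOn_fderiv_slice hΩ hg).clm_apply
      (contDiffOn_const (c := ((0 : P), v)))).continuousOn) hI).intervalIntegrable_of_Icc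
        zero_le_one

/-- The Poincaré lemma for 2-forms on a convex open set. -/
theorem exists_primitive_two_form {B : Set E} (hB : IsOpen B) (hconv : Convex ℝ B)
    {p : E} (hp : p ∈ B) {w : E → E →L[ℝ] E →L[ℝ] ℝ} (hw : ContDiffOn ℝ ∞ w B)
    (hanti : ∀ x ∈ B, ∀ u v, w x u v = -w x v u)
    (hc : ∀ x ∈ B, ∀ u v r,
      fderiv ℝ w x u v r + fderiv ℝ w x v r u + fderiv ℝ w x r u v = 0) :
    ∃ α : E → E →L[ℝ] ℝ, ContDiffOn ℝ ∞ α B ∧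
      ∀ x ∈ B, ∀ u v, fderiv ℝ α x u v - fderiv ℝ α x v u = w x u v := by
  have hantiD : ∀ x ∈ B, ∀ s u v, fderiv ℝ w x s u v = -fderiv ℝ w x s v u := by
    intro x hx s u v
    have hd := hw.differentiableAt_of_isOpen hB hx
    have e : ∀ u v, fderiv ℝ (fun x => w x u v) x s = fderiv ℝ w x s u v := fun u v => by
      rw [fderiv_clm_apply (hd.clm_apply (differentiableAt_const u)) (differentiableAt_const v),
        fderiv_clm_apply hd (differentiableAt_const u)]
      simp
    rw [← e, ← e, Set.EqOn.fderiv_eq_of_isOpen (g := fun x => -w x v u) hB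
      (fun x hx => hanti x hx u v) hx, fderiv_fun_neg]
    rfl
  let γ : E × ℝ → E := fun q => p + q.2 • (q.1 - p)
  have hγ : ContDiff ℝ ∞ γ := by fun_prop
  let g : E × ℝ → E →L[ℝ] ℝ := fun q => q.2 • w (γ q) (q.1 - p)
  have hΩ : IsOpen (γ ⁻¹' B) := hB.preimage hγ.continuous
  have hg : ContDiffOn ℝ ∞ g (γ ⁻¹' B) :=
    contDiffOn_snd.smul ((hw.comp hγ.contDiffOn (Set.mapsTo_preimage γ B)).clm_apply (by fun_prop))
  have hB' : ∀ x ∈ B, ∀ t ∈ Set.Icc (0 : ℝ) 1, (x, t) ∈ γ ⁻¹' B := fun x hx t ht =>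
    hconv.add_smul_sub_mem hp hx ht
  refine ⟨fun x => ∫ t in (0 : ℝ)..1, g (x, t),
    (contDiffOn_integral_of_contDiffOn hΩ hg).mono hB', fun x hx u v => ?_⟩
  have hI := hB' x hx
  have hcont := (contDiffOn_fderiv_slice hΩ hg)
  have hint : ∀ u v, IntervalIntegrable
      (fun t => (fderiv ℝ g (x, t)).comp (ContinuousLinearMap.inl ℝ E ℝ) u v)
        MeasureTheory.volume 0 1 := fun u v =>
    intervalIntegrable_slice ((hcont.clm_apply contDiffOn_const).clm_apply
      contDiffOn_const).continuousOn hI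
  rw [(hasFDerivAt_integral_of_contDiffOn hΩ hg hI).fderiv]
  have happ : ∀ u v, (∫ t in (0 : ℝ)..1,
      (fderiv ℝ g (x, t)).comp (ContinuousLinearMap.inl ℝ E ℝ)) u v
      = ∫ t in (0 : ℝ)..1, (fderiv ℝ g (x, t)).comp (ContinuousLinearMap.inl ℝ E ℝ) u v := by
    intro u v
    rw [ContinuousLinearMap.intervalIntegral_apply
        (intervalIntegrable_slice hcont.continuousOn hI),
      ContinuousLinearMap.intervalIntegral_apply
        (intervalIntegrable_slice (hcont.clm_apply contDiffOn_const).continuousOn hI)]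
  rw [happ, happ, ← intervalIntegral.integral_sub (hint u v) (hint v u)]
  -- The integrand is the `t`-derivative of `t² w(p + t (x - p))(u, v)`, since `w` is closed.
  have hderiv : ∀ t ∈ Set.uIcc (0 : ℝ) 1, HasDerivAt (fun t => t ^ 2 * w (γ (x, t)) u v)
      ((fderiv ℝ g (x, t)).comp (ContinuousLinearMap.inl ℝ E ℝ) u v
        - (fderiv ℝ g (x, t)).comp (ContinuousLinearMap.inl ℝ E ℝ) v u) t := by
    intro t ht
    rw [Set.uIcc_of_le zero_le_one] at ht
    have hwt : HasFDerivAt w (fderiv ℝ w (γ (x, t))) (γ (x, t)) :=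
      (hw.differentiableAt_of_isOpen hB (hI t ht)).hasFDerivAt
    have h1 : HasDerivAt (fun t : ℝ => γ (x, t)) (x - p) t :=
      (((hasDerivAt_id t).smul_const (x - p)).const_add p).congr_deriv (one_smul _ _)
    have h2 : HasDerivAt (fun t => w (γ (x, t))) (fderiv ℝ w (γ (x, t)) (x - p)) t :=
      HasFDerivAt.comp_hasDerivAt (l := w) (f := fun t => γ (x, t)) t hwt h1
    have h2' : HasDerivAt (fun t => w (γ (x, t)) u v) (fderiv ℝ w (γ (x, t)) (x - p) u v) t :=
      ((h2.clm_apply (hasDerivAt_const t u)).clm_apply (hasDerivAt_const t v)).congr_deriv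
        (by simp)
    have h3 : HasFDerivAt (fun y : E => γ (y, t)) (t • ContinuousLinearMap.id ℝ E) x :=
      (((hasFDerivAt_id x).sub_const p).const_smul t).const_add p
    have h4 : HasFDerivAt (fun y : E => w (γ (y, t))) _ x :=
      HasFDerivAt.comp (g := w) (f := fun y => γ (y, t)) x hwt h3
    have h5 := (h4.clm_apply ((hasFDerivAt_id x).sub_const p)).const_smul t
    rw [(hasFDerivAt_slice hΩ hg (hI t ht)).unique h5]
    refine ((hasDerivAt_pow 2 t).fun_mul h2').congr_deriv ?_
    have h6 := hc _ (hI t ht) u v (x - p)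
    have h7 := hantiD _ (hI t ht) u v (x - p)
    have h8 := hanti _ (hI t ht) u v
    simp [-map_sub]
    linear_combination t ^ 2 * h6 - t ^ 2 * h7 + t * h8
  rw [intervalIntegral.integral_eq_sub_of_hasDerivAt hderiv ((hint u v).sub (hint v u))]
  simp [γ]

end Homotopy

/-! ### Primitives along the fibres of a slit bundle -/

section SlitFiber

variable {P E : Type} [NormedAddCommGroup P] [NormedSpace ℝ P] [NormedAddCommGroup E]
  [NormedSpace ℝ E]

theorem hasFDerivAt_fiber {f : P × E → ℝ} {x : P} {y : E} (hf : DifferentiableAt ℝ f (x, y)) :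
    HasFDerivAt (fun y => f (x, y))
      ((fderiv ℝ f (x, y)).comp (ContinuousLinearMap.inr ℝ P E)) y :=
  hf.hasFDerivAt.comp y (hasFDerivAt_prodMk_right x y)

/-- A function whose fibre derivative vanishes is constant on a connected open part of a fibre. -/
theorem eq_of_fiberDeriv_eq_zero {f : P × E → ℝ} {x : P} {K : Set E} (hK : IsOpen K)
    (hK' : IsPreconnected K) (hf : ∀ y ∈ K, DifferentiableAt ℝ f (x, y))
    (h0 : ∀ y ∈ K, ∀ v, fderiv ℝ f (x, y) (0, v) = 0) {y y' : E} (hy : y ∈ K) (hy' : y' ∈ K) :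
    f (x, y) = f (x, y') := by
  refine hK.is_const_of_fderiv_eq_zero (𝕜 := ℝ) hK' (f := fun y => f (x, y))
    (fun w hw => (hasFDerivAt_fiber (hf w hw)).differentiableAt.differentiableWithinAt)
    (fun w hw => ?_) hy hy'
  rw [(hasFDerivAt_fiber (hf w hw)).fderiv]
  ext v
  simpa using h0 w hw v

variable {a y : E}

theorem segment_ne_zero_of_notMem_span (ha : a ≠ 0) (hy : y ∉ Submodule.span ℝ {a}) (t : ℝ) :
    a + t • (y - a) ≠ 0 := by
  intro h
  have ht : t ≠ 0 := by
    rintro rfl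
    simp [ha] at h
  refine hy (Submodule.mem_span_singleton.2 ⟨t⁻¹ * (t - 1), ?_⟩)
  have : t • y = (t - 1) • a := by
    linear_combination (norm := module) h
  rw [mul_smul, ← this, smul_smul, inv_mul_cancel₀ ht, one_smul]

/-- The segments from `a` and from `-a` to a point `y ≠ 0` do not both pass through the origin. -/
theorem segment_ne_zero_or (ha : a ≠ 0) (hy : y ≠ 0) :
    (∀ t ∈ Set.Icc (0 : ℝ) 1, a + t • (y - a) ≠ 0) ∨
      ∀ t ∈ Set.Icc (0 : ℝ) 1, -a + t • (y - -a) ≠ 0 := by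
  by_contra! h
  obtain ⟨⟨t, ht, h1⟩, ⟨s, hs, h2⟩⟩ := h
  have e1 : t • y = (t - 1) • a := by linear_combination (norm := module) h1
  have e2 : s • y = (1 - s) • a := by linear_combination (norm := module) h2
  have e3 : (s * (t - 1)) • a = (t * (1 - s)) • a := by
    rw [mul_smul, ← e1, mul_smul, ← e2, smul_smul, smul_smul, mul_comm]
  have e4 := smul_left_injective ℝ ha e3
  have ht1 : t = 1 ∨ s = 0 := by
    have h5 : s * (1 - t) = 0 := by
      linarith [mul_nonneg hs.1 (sub_nonneg.2 ht.2), mul_nonneg ht.1 (sub_nonneg.2 hs.2)]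
    rcases mul_eq_zero.1 h5 with h | h
    · exact Or.inr h
    · exact Or.inl (by linarith)
  rcases ht1 with rfl | rfl
  · simp at e1
    exact hy e1
  · simp at e2
    exact ha e2.symm

/-- Where both segments avoid the origin, `y` is not a multiple of `a`. -/
theorem notMem_span_of_segment_ne_zero
    (h1 : ∀ t ∈ Set.Icc (0 : ℝ) 1, a + t • (y - a) ≠ 0)
    (h2 : ∀ t ∈ Set.Icc (0 : ℝ) 1, -a + t • (y - -a) ≠ 0) : y ∉ Submodule.span ℝ {a} := by
  intro h
  obtain ⟨c, rfl⟩ := Submodule.mem_span_singleton.1 h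
  rcases le_total 0 c with hc | hc
  · have hc' : c + 1 ≠ 0 := by positivity
    refine h2 (1 / (c + 1)) ⟨by positivity, (div_le_one (by positivity)).2 (by linarith)⟩ ?_
    have : c • a - -a = (c + 1) • a := by module
    rw [this, smul_smul, one_div_mul_cancel hc', one_smul, neg_add_cancel]
  · have hc' : 0 < 1 - c := by linarith
    refine h1 (1 / (1 - c)) ⟨by positivity, (div_le_one hc').2 (by linarith)⟩ ?_
    have : c • a - a = -((1 - c) • a) := by module
    rw [this, smul_neg, smul_smul, one_div_mul_cancel hc'.ne', one_smul, add_neg_cancel]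

theorem isPreconnected_compl_span_singleton [FiniteDimensional ℝ E]
    (hE : 2 < Module.finrank ℝ E) (a : E) :
    IsPreconnected ((Submodule.span ℝ {a} : Submodule ℝ E) : Set E)ᶜ := by
  refine (isPathConnected_compl_of_one_lt_codim ?_).isConnected.isPreconnected
  rw [← Module.finrank_eq_rank, Nat.one_lt_cast]
  have h1 := (Submodule.span ℝ {a}).finrank_quotient_add_finrank
  have h2 := finrank_span_le_card (R := ℝ) ({a} : Set E)
  simp only [Set.toFinset_singleton, Finset.card_singleton] at h2
  omega

/-- On the slit fibres of dimension at least three, which are simply connected, a smooth family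
of closed 1-forms has a smooth family of primitives. The primitives centred at `a` and `-a` are
defined off opposite rays; they differ by a constant off the line `ℝ a`, whose complement is
connected. -/
theorem exists_fiber_primitive_slit [FiniteDimensional ℝ E] (hE : 2 < Module.finrank ℝ E)
    {B : Set P} (hB : IsOpen B) {η : P × E → E →L[ℝ] ℝ}
    (hη : ContDiffOn ℝ ∞ η (B ×ˢ {0}ᶜ))
    (hc : ∀ z ∈ B ×ˢ ({0}ᶜ : Set E), ∀ v w, fderiv ℝ η z (0, v) w = fderiv ℝ η z (0, w) v) :
    ∃ f : P × E → ℝ, ContDiffOn ℝ ∞ f (B ×ˢ {0}ᶜ) ∧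
      ∀ z ∈ B ×ˢ ({0}ᶜ : Set E), ∀ v, fderiv ℝ f z (0, v) = η z v := by
  classical
  have hO : IsOpen (B ×ˢ ({0}ᶜ : Set E)) := hB.prod isOpen_compl_singleton
  have : Nontrivial E := Module.nontrivial_of_finrank_pos (R := ℝ) (by omega)
  obtain ⟨a, ha⟩ := exists_ne (0 : E)
  have hspan : Submodule.span ℝ {a} ≠ ⊤ := by
    intro h
    have h2 := finrank_span_le_card (R := ℝ) ({a} : Set E)
    rw [h, finrank_top] at h2
    simp only [Set.toFinset_singleton, Finset.card_singleton] at h2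
    omega
  obtain ⟨b, hb⟩ : ∃ b, b ∉ Submodule.span ℝ {a} := by
    by_contra! h
    exact hspan (eq_top_iff.2 fun x _ => h x)
  obtain ⟨f₁, ho₁, hf₁, hd₁⟩ := exists_fiber_primitive_of_starShaped hO hη hc a
  obtain ⟨f₂, ho₂, hf₂, hd₂⟩ := exists_fiber_primitive_of_starShaped hO hη hc (-a)
  set S₁ : Set (P × E) :=
    {z | ∀ t ∈ Set.Icc (0 : ℝ) 1, (z.1, a + t • (z.2 - a)) ∈ B ×ˢ ({0}ᶜ : Set E)} with hS₁
  set S₂ : Set (P × E) :=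
    {z | ∀ t ∈ Set.Icc (0 : ℝ) 1, (z.1, -a + t • (z.2 - -a)) ∈ B ×ˢ ({0}ᶜ : Set E)} with hS₂
  have hK : IsOpen ((Submodule.span ℝ {a} : Submodule ℝ E) : Set E)ᶜ :=
    (Submodule.closed_of_finiteDimensional _).isOpen_compl
  have hmem₁ : ∀ x ∈ B, ∀ y ∉ Submodule.span ℝ {a}, (x, y) ∈ S₁ := fun x hx y hy t _ =>
    ⟨hx, segment_ne_zero_of_notMem_span ha hy t⟩
  have hmem₂ : ∀ x ∈ B, ∀ y ∉ Submodule.span ℝ {a}, (x, y) ∈ S₂ := fun x hx y hy t _ =>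
    ⟨hx, segment_ne_zero_of_notMem_span (neg_ne_zero.2 ha) (by
      rwa [← Set.neg_singleton, Submodule.span_neg]) t⟩
  have hcover : ∀ z ∈ B ×ˢ ({0}ᶜ : Set E), z ∈ S₁ ∨ z ∈ S₂ := fun z hz =>
    (segment_ne_zero_or ha hz.2).imp (fun h t ht => ⟨hz.1, h t ht⟩) fun h t ht => ⟨hz.1, h t ht⟩
  have hB₁ : ∀ z ∈ S₁, z.1 ∈ B := fun z hz => (hz 0 ⟨le_rfl, zero_le_one⟩).1
  have hB₂ : ∀ z ∈ S₂, z.1 ∈ B := fun z hz => (hz 0 ⟨le_rfl, zero_le_one⟩).1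
  have hglue : ∀ z ∈ S₁, z ∈ S₂ → f₁ z = f₂ z + (f₁ (z.1, b) - f₂ (z.1, b)) := by
    intro z h1 h2
    have hy : z.2 ∉ Submodule.span ℝ {a} :=
      notMem_span_of_segment_ne_zero (fun t ht => (h1 t ht).2) fun t ht => (h2 t ht).2
    have hx := hB₁ z h1
    have hd1 : ∀ y ∉ Submodule.span ℝ {a}, DifferentiableAt ℝ f₁ (z.1, y) := fun y hy =>
      hf₁.differentiableAt_of_isOpen ho₁ (hmem₁ _ hx y hy)
    have hd2 : ∀ y ∉ Submodule.span ℝ {a}, DifferentiableAt ℝ f₂ (z.1, y) := fun y hy =>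
      hf₂.differentiableAt_of_isOpen ho₂ (hmem₂ _ hx y hy)
    have := eq_of_fiberDeriv_eq_zero (f := fun w => f₁ w - f₂ w) (x := z.1) hK
      (isPreconnected_compl_span_singleton hE a)
      (fun y hy => (hd1 y hy).fun_sub (hd2 y hy)) (fun y hy v => by
        rw [fderiv_fun_sub (hd1 y hy) (hd2 y hy)]
        simp [hd₁ _ (hmem₁ _ hx y hy), hd₂ _ (hmem₂ _ hx y hy)]) hy hb
    simp only [Prod.mk.eta] at this
    linarith
  let c : P × E → ℝ := fun z => f₁ (z.1, b) - f₂ (z.1, b)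
  have hι : ContDiff ℝ ∞ (fun z : P × E => (z.1, b)) := by fun_prop
  have hc' : ContDiffOn ℝ ∞ c S₂ :=
    (hf₁.comp hι.contDiffOn fun z hz => hmem₁ _ (hB₂ z hz) b hb).sub
      (hf₂.comp hι.contDiffOn fun z hz => hmem₂ _ (hB₂ z hz) b hb)
  have hcd : ∀ z ∈ S₂, ∀ v, fderiv ℝ c z (0, v) = 0 := by
    intro z hz v
    have hx := hB₂ z hz
    have h1 := (hf₁.differentiableAt_of_isOpen ho₁ (hmem₁ _ hx b hb)).fun_sub
      (hf₂.differentiableAt_of_isOpen ho₂ (hmem₂ _ hx b hb))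
    have h2 : HasFDerivAt (fun w : P × E => (w.1, b))
        ((ContinuousLinearMap.fst ℝ P E).prod 0) z :=
      hasFDerivAt_fst.prodMk (hasFDerivAt_const b z)
    have h3 : HasFDerivAt c _ z :=
      HasFDerivAt.comp (g := fun w => f₁ w - f₂ w) (f := fun w : P × E => (w.1, b)) z
        h1.hasFDerivAt h2
    rw [h3.fderiv]
    exact (fderiv ℝ (fun w => f₁ w - f₂ w) (z.1, b)).map_zero
  let f : P × E → ℝ := fun z => if z ∈ S₁ then f₁ z else f₂ z + c z
  have hfS₁ : Set.EqOn f f₁ S₁ := fun z hz => if_pos hz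
  have hfS₂ : Set.EqOn f (fun z => f₂ z + c z) S₂ := fun z hz => by
    by_cases h : z ∈ S₁
    · exact (if_pos h).trans (hglue z h hz)
    · exact if_neg h
  refine ⟨f, fun z hz => ?_, fun z hz v => ?_⟩
  · refine ContDiffAt.contDiffWithinAt ?_
    rcases hcover z hz with h | h
    · exact (hf₁.congr hfS₁).contDiffAt_of_isOpen ho₁ h
    · exact ((hf₂.add hc').congr hfS₂).contDiffAt_of_isOpen ho₂ h
  · rcases hcover z hz with h | h
    · rw [hfS₁.fderiv_eq_of_isOpen ho₁ h, hd₁ z h]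
    · rw [hfS₂.fderiv_eq_of_isOpen ho₂ h,
        fderiv_fun_add (hf₂.differentiableAt_of_isOpen ho₂ h)
          (hc'.differentiableAt_of_isOpen ho₂ h), add_apply, hd₂ z h, hcd z h, add_zero]

end SlitFiber

/-! ### Local reconstruction of the semi-basic 1-form in coordinates -/

section LocalExistence

variable {D : Set (Phase n)} {z : Phase n} {G : Fin n → Phase n → ℝ} {f : Phase n → ℝ}

theorem base_eq_sum (v : Base n) : v = ∑ k, v k • EuclideanSpace.single k (1 : ℝ) := by
  ext i
  simp [Pi.single_apply]

theorem fderiv_vertical_eq_sum (f : Phase n → ℝ) (z : Phase n) (v : Base n) :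
    fderiv ℝ f z (0, v) = ∑ k, v k * V k f z := by
  have : ((0, v) : Phase n) = ∑ k, v k • ddy k := by
    refine Prod.ext ?_ ?_
    · simp [Prod.fst_sum, ddy]
    · simpa [Prod.snd_sum, ddy] using base_eq_sum v
  rw [this, map_sum]
  simp [V]

theorem fderiv_comp_fst {A : Base n → ℝ} (hA : DifferentiableAt ℝ A z.1) (u : Phase n) :
    fderiv ℝ (fun w : Phase n => A w.1) z u = fderiv ℝ A z.1 u.1 := by
  have h : HasFDerivAt (fun w : Phase n => A w.1) _ z :=
    HasFDerivAt.comp (g := A) (f := Prod.fst) z hA.hasFDerivAt hasFDerivAt_fst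
  rw [h.fderiv]
  rfl

theorem fderiv_sum_smul_const {ι F E : Type*} [Fintype ι] [NormedAddCommGroup E] [NormedSpace ℝ E]
    [NormedAddCommGroup F] [NormedSpace ℝ F] {g : ι → E → ℝ} {L : ι → F} {x : E}
    (hg : ∀ i, DifferentiableAt ℝ (g i) x) (u : E) :
    fderiv ℝ (fun w => ∑ i, g i w • L i) x u = ∑ i, fderiv ℝ (g i) x u • L i := by
  rw [(HasFDerivAt.fun_sum fun i _ => (hg i).hasFDerivAt.smul_const (L i)).fderiv]
  simp

theorem contDiffOn_sum_smul_const {ι F E : Type*} [Fintype ι] [NormedAddCommGroup E]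
    [NormedSpace ℝ E] [NormedAddCommGroup F] [NormedSpace ℝ F] {g : ι → E → ℝ} {L : ι → F}
    {s : Set E} (hg : ∀ i, ContDiffOn ℝ ∞ (g i) s) :
    ContDiffOn ℝ ∞ (fun w => ∑ i, g i w • L i) s :=
  ContDiffOn.sum fun i _ => (hg i).smul contDiffOn_const

/-- The coordinate covector `vᵢ`. -/
def coordCovector (i : Fin n) : Base n →L[ℝ] ℝ := EuclideanSpace.proj i

@[simp] theorem coordCovector_apply (i : Fin n) (v : Base n) : coordCovector i v = v i := rfl

/-- Functions `θⱼ` with `Vᵢ(θⱼ) = hᵢⱼ`, from the first and third Helmholtz conditions. -/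
theorem exists_vertical_potential (hn : 3 ≤ n) {B : Set (Base n)} (hB : IsOpen B)
    {h : Fin n → Fin n → Phase n → ℝ} (hh : ∀ i j, ContDiffOn ℝ ∞ (h i j) (B ×ˢ {0}ᶜ))
    (hs : ∀ z ∈ B ×ˢ ({0}ᶜ : Set (Base n)), ∀ i j, h j i z = h i j z)
    (hv : ∀ z ∈ B ×ˢ ({0}ᶜ : Set (Base n)), ∀ i j k, V k (h i j) z = V j (h i k) z) :
    ∃ θ : Fin n → Phase n → ℝ, (∀ j, ContDiffOn ℝ ∞ (θ j) (B ×ˢ {0}ᶜ)) ∧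
      ∀ z ∈ B ×ˢ ({0}ᶜ : Set (Base n)), ∀ i j, V i (θ j) z = h i j z := by
  have hO : IsOpen (B ×ˢ ({0}ᶜ : Set (Base n))) := hB.prod isOpen_compl_singleton
  have key : ∀ j, ∃ f : Phase n → ℝ, ContDiffOn ℝ ∞ f (B ×ˢ {0}ᶜ) ∧
      ∀ z ∈ B ×ˢ ({0}ᶜ : Set (Base n)), ∀ v, fderiv ℝ f z (0, v)
        = (∑ i, h i j z • coordCovector i : Base n →L[ℝ] ℝ) v := by
    intro j
    refine exists_fiber_primitive_slit (η := fun z => ∑ i, h i j z • coordCovector i)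
      (by simp; omega) hB (contDiffOn_sum_smul_const fun i => hh i j) ?_
    intro z hz v w
    have hsym : ∀ i k, V k (h i j) z = V i (h k j) z := fun i k => by
      rw [V_eq_of_eqOn hO (g := h j i) (fun w hw => hs w hw j i) hz, hv z hz,
        V_eq_of_eqOn hO (g := h k j) (fun w hw => hs w hw k j) hz]
    have e : ∀ v w : Base n, fderiv ℝ (fun z => ∑ i, h i j z • coordCovector i) z (0, v) w
        = ∑ i, ∑ k, v k * w i * V k (h i j) z := fun v w => by
      refine (congrArg (fun T : Base n →L[ℝ] ℝ => T w) (fderiv_sum_smul_const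
        (g := fun i => h i j) (L := coordCovector)
        (fun i => (hh i j).differentiableAt_of_isOpen hO hz) (0, v))).trans ?_
      simp only [sum_apply, smul_apply, coordCovector_apply, smul_eq_mul,
        fderiv_vertical_eq_sum, Finset.sum_mul]
      exact Finset.sum_congr rfl fun i _ => Finset.sum_congr rfl fun k _ => by ring
    rw [e, e, Finset.sum_comm]
    exact Finset.sum_congr rfl fun i _ => Finset.sum_congr rfl fun k _ => by
      rw [hsym]; ring
  choose θ hθ hd using key
  refine ⟨θ, hθ, fun z hz i j => ?_⟩
  rw [V, ddy, hd j z hz]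
  simp [sum_apply]

/-- Basic functions `κᵢⱼ` on a product with slit fibres that satisfy `Hᵢ(κⱼₖ) + cyclic = 0` are
the components of an exact 2-form on a convex base. -/
theorem exists_basic_potential (hn : 2 ≤ n) {B : Set (Base n)} (hB : IsOpen B)
    (hconv : Convex ℝ B) {p : Base n} (hp : p ∈ B) {κ : Fin n → Fin n → Phase n → ℝ}
    (hκ : ∀ i j, ContDiffOn ℝ ∞ (κ i j) (B ×ˢ {0}ᶜ))
    (hanti : ∀ z ∈ B ×ˢ ({0}ᶜ : Set (Base n)), ∀ i j, κ j i z = -κ i j z)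
    (hV : ∀ z ∈ B ×ˢ ({0}ᶜ : Set (Base n)), ∀ k i j, V k (κ i j) z = 0)
    (hc : ∀ z ∈ B ×ˢ ({0}ᶜ : Set (Base n)), ∀ i j k,
      H G i (κ j k) z + H G j (κ k i) z + H G k (κ i j) z = 0) :
    ∃ α : Base n → Base n →L[ℝ] ℝ, ContDiffOn ℝ ∞ α B ∧
      ∀ z ∈ B ×ˢ ({0}ᶜ : Set (Base n)), ∀ i j,
        fderiv ℝ α z.1 (EuclideanSpace.single i 1) (EuclideanSpace.single j 1)
          - fderiv ℝ α z.1 (EuclideanSpace.single j 1) (EuclideanSpace.single i 1) = κ i j z := by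
  have hO : IsOpen (B ×ˢ ({0}ᶜ : Set (Base n))) := hB.prod isOpen_compl_singleton
  have hE : 1 < Module.finrank ℝ (Base n) := by simp; omega
  have : Nontrivial (Base n) := Module.nontrivial_of_finrank_pos (R := ℝ) (by omega)
  obtain ⟨b, hb⟩ := exists_ne (0 : Base n)
  have hmem : ∀ x ∈ B, (x, b) ∈ B ×ˢ ({0}ᶜ : Set (Base n)) := fun x hx => ⟨hx, hb⟩
  have hconst : ∀ z ∈ B ×ˢ ({0}ᶜ : Set (Base n)), ∀ i j, κ i j z = κ i j (z.1, b) := by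
    intro z hz i j
    refine eq_of_fiberDeriv_eq_zero (f := κ i j) (x := z.1) (y := z.2) (y' := b)
      isOpen_compl_singleton (isConnected_compl_singleton_of_one_lt_rank
        (by rwa [← Module.finrank_eq_rank, Nat.one_lt_cast]) 0).isPreconnected
      (fun y hy => (hκ i j).differentiableAt_of_isOpen hO ⟨hz.1, hy⟩) (fun y hy v => ?_) hz.2 hb
    rw [fderiv_vertical_eq_sum]
    exact Finset.sum_eq_zero fun k _ => by
      rw [hV (z.1, y) ⟨hz.1, hy⟩, mul_zero]
  let L : Fin n × Fin n → Base n →L[ℝ] Base n →L[ℝ] ℝ := fun q =>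
    (coordCovector q.1).smulRight (coordCovector q.2)
  let g : Fin n × Fin n → Base n → ℝ := fun q x => κ q.1 q.2 (x, b)
  have hg : ∀ q, ContDiffOn ℝ ∞ (g q) B := fun q =>
    (hκ q.1 q.2).comp (by fun_prop : ContDiff ℝ ∞ fun x : Base n => (x, b)).contDiffOn hmem
  let w : Base n → Base n →L[ℝ] Base n →L[ℝ] ℝ := fun x => ∑ q, g q x • L q
  have hw : ContDiffOn ℝ ∞ w B := contDiffOn_sum_smul_const hg
  have hw_apply : ∀ x u v, w x u v = ∑ i, ∑ j, κ i j (x, b) * (u i * v j) := fun x u v => by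
    simp [w, g, L, sum_apply, Fintype.sum_prod_type]
  -- As `κ` is basic, the horizontal derivatives are the derivatives along the base.
  have hgd : ∀ x ∈ B, ∀ i j u, fderiv ℝ (g (i, j)) x u = ∑ k, u k * H G k (κ i j) (x, b) := by
    intro x hx i j u
    have h1 : HasFDerivAt (g (i, j)) _ x :=
      HasFDerivAt.comp (g := κ i j) (f := fun x => (x, b)) x
        ((hκ i j).differentiableAt_of_isOpen hO (hmem x hx)).hasFDerivAt
        (hasFDerivAt_prodMk_left x b)
    have h2 : ∀ k, H G k (κ i j) (x, b) = fderiv ℝ (κ i j) (x, b) (ddx k) := fun k => by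
      simp only [H, horField, map_sub, map_sum, map_smul, smul_eq_mul]
      rw [sub_eq_self]
      refine Finset.sum_eq_zero fun m _ => ?_
      have := hV _ (hmem x hx) m i j
      rw [V] at this
      rw [this, mul_zero]
    have h3 : ((u, 0) : Phase n) = ∑ k, u k • ddx k := by
      refine Prod.ext ?_ ?_
      · simpa [Prod.fst_sum, ddx] using base_eq_sum u
      · simp [Prod.snd_sum, ddx]
    rw [h1.fderiv]
    simp only [h2, ContinuousLinearMap.comp_apply, ContinuousLinearMap.inl_apply, h3, map_sum,
      map_smul, smul_eq_mul]
  have hwd : ∀ x ∈ B, ∀ u v r, fderiv ℝ w x u v r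
      = ∑ k, ∑ i, ∑ j, u k * v i * r j * H G k (κ i j) (x, b) := by
    intro x hx u v r
    refine (congrArg (fun T : Base n →L[ℝ] Base n →L[ℝ] ℝ => T v r) (fderiv_sum_smul_const
      (g := g) (L := L) (fun q => (hg q).differentiableAt_of_isOpen hB hx) u)).trans ?_
    simp only [sum_apply, smul_apply, L, ContinuousLinearMap.smulRight_apply, coordCovector_apply,
      smul_eq_mul, Fintype.sum_prod_type, hgd x hx, Finset.sum_mul]
    rw [Finset.sum_comm_cycle]
    exact Finset.sum_congr rfl fun k _ => Finset.sum_congr rfl fun i _ =>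
      Finset.sum_congr rfl fun j _ => by ring
  have hwanti : ∀ x ∈ B, ∀ u v, w x u v = -w x v u := by
    intro x hx u v
    rw [hw_apply, hw_apply, Finset.sum_comm, ← Finset.sum_neg_distrib]
    refine Finset.sum_congr rfl fun i _ => ?_
    rw [← Finset.sum_neg_distrib]
    exact Finset.sum_congr rfl fun j _ => by rw [hanti _ (hmem x hx) i j]; ring
  have hwc : ∀ x ∈ B, ∀ u v r,
      fderiv ℝ w x u v r + fderiv ℝ w x v r u + fderiv ℝ w x r u v = 0 := by
    intro x hx u v r
    have e1 : fderiv ℝ w x v r u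
        = ∑ k, ∑ i, ∑ j, u k * v i * r j * H G i (κ j k) (x, b) := by
      rw [hwd x hx, Finset.sum_comm_cycle]
      exact Finset.sum_congr rfl fun k _ => Finset.sum_congr rfl fun i _ =>
        Finset.sum_congr rfl fun j _ => by ring
    have e2 : fderiv ℝ w x r u v
        = ∑ k, ∑ i, ∑ j, u k * v i * r j * H G j (κ k i) (x, b) := by
      rw [hwd x hx, ← Finset.sum_comm_cycle]
      exact Finset.sum_congr rfl fun k _ => Finset.sum_congr rfl fun i _ =>
        Finset.sum_congr rfl fun j _ => by ring
    rw [hwd x hx, e1, e2]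
    simp only [← Finset.sum_add_distrib]
    refine Finset.sum_eq_zero fun k _ => Finset.sum_eq_zero fun i _ =>
      Finset.sum_eq_zero fun j _ => ?_
    linear_combination u k * v i * r j * hc _ (hmem x hx) k i j
  obtain ⟨α, hα, hαd⟩ := exists_primitive_two_form hB hconv hp hw hwanti hwc
  refine ⟨α, hα, fun z hz i j => ?_⟩
  rw [hαd _ hz.1, hconst z hz, hw_apply]
  simp

/-- Local existence in coordinates: the Helmholtz conditions on a convex base with slit fibres
yield `θⱼ` with `Vᵢ(θⱼ) = hᵢⱼ` and `Hᵢ(θⱼ) = Hⱼ(θᵢ)`. -/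
theorem exists_local_potential (hn : 3 ≤ n) {B : Set (Base n)} (hB : IsOpen B)
    (hconv : Convex ℝ B) {p : Base n} (hp : p ∈ B)
    (hG : ∀ i, ContDiffOn ℝ ∞ (G i) (B ×ˢ {0}ᶜ))
    (hE : ∀ z ∈ B ×ˢ ({0}ᶜ : Set (Base n)), ∀ i, ∑ k, z.2 k * V k (G i) z = 2 * G i z)
    {h : Fin n → Fin n → Phase n → ℝ} (hh : ∀ i j, ContDiffOn ℝ ∞ (h i j) (B ×ˢ {0}ᶜ))
    (hs : ∀ z ∈ B ×ˢ ({0}ᶜ : Set (Base n)), ∀ i j, h j i z = h i j z)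
    (hy : ∀ z ∈ B ×ˢ ({0}ᶜ : Set (Base n)), ∀ i, ∑ j, z.2 j * h i j z = 0)
    (hv : ∀ z ∈ B ×ˢ ({0}ᶜ : Set (Base n)), ∀ i j k, V k (h i j) z = V j (h i k) z)
    (hN : ∀ z ∈ B ×ˢ ({0}ᶜ : Set (Base n)), ∀ i j, (∑ k, z.2 k * H G k (h i j) z)
      - (∑ k, gammaCoeff G k i z * h k j z) - ∑ k, gammaCoeff G k j z * h i k z = 0)
    (hW : ∀ z ∈ B ×ˢ ({0}ᶜ : Set (Base n)), ∀ i j,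
      ∑ k, h i k z * weyl G k j z = ∑ k, h j k z * weyl G k i z) :
    ∃ θ : Fin n → Phase n → ℝ, (∀ j, ContDiffOn ℝ ∞ (θ j) (B ×ˢ {0}ᶜ)) ∧
      (∀ z ∈ B ×ˢ ({0}ᶜ : Set (Base n)), ∀ i j, V i (θ j) z = h i j z) ∧
      ∀ z ∈ B ×ˢ ({0}ᶜ : Set (Base n)), ∀ i j, horCurl G θ i j z = 0 := by
  have hO : IsOpen (B ×ˢ ({0}ᶜ : Set (Base n))) := hB.prod isOpen_compl_singleton
  obtain ⟨θ, hθ, hθh⟩ := exists_vertical_potential hn hB hh hs hv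
  have hS : ∀ z ∈ B ×ˢ ({0}ᶜ : Set (Base n)), ∀ i j, V i (θ j) z = V j (θ i) z :=
    fun z hz i j => by rw [hθh z hz, hθh z hz, hs z hz]
  have hZ : ∀ z ∈ B ×ˢ ({0}ᶜ : Set (Base n)), ∀ j, ∑ k, z.2 k * V k (θ j) z = 0 :=
    fun z hz j => by
      rw [← hy z hz j]
      exact Finset.sum_congr rfl fun k _ => by rw [hθh z hz, hs z hz]
  have hN' : ∀ z ∈ B ×ˢ ({0}ᶜ : Set (Base n)), ∀ i j,
      ∑ k, z.2 k * V i (horCurl G θ k j) z = 0 := fun z hz i j => by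
    rw [nabla_vertDeriv_eq hO hG hE hθ hS hZ hz, ← hN z hz i j]
    have e : ∀ k, H G k (V i (θ j)) z = H G k (h i j) z := fun k =>
      H_eq_of_eqOn hO (fun w hw => hθh w hw i j) hz k
    simp only [e, hθh z hz]
  have hω := fun z (hz : z ∈ B ×ˢ ({0}ᶜ : Set (Base n))) k i j =>
    V_horCurl_eq_zero hO hG hθ hN' hz k i j
  have hR : ∀ z ∈ B ×ˢ ({0}ᶜ : Set (Base n)), ∀ i j,
      (∑ l, jacobi G l j z * V l (θ i) z) - ∑ l, jacobi G l i z * V l (θ j) z = 0 :=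
    fun z hz i j => by
      simp only [hθh z hz]
      exact (weyl_symm_iff (h := fun i j => h i j z) (hs z hz) (hy z hz) i j).1 (hW z hz i j)
  -- `d_H θ` is basic and closed; subtracting a basic potential of it from `θ` makes it vanish
  -- and leaves `Vᵢ(θⱼ)` unchanged.
  obtain ⟨α, hα, hαω⟩ := exists_basic_potential (G := G) (by omega) hB hconv hp
    (fun i j => contDiffOn_horCurl hO hG hθ i j) (fun z _ i j => horCurl_antisymm G θ i j z) hω
    (fun z hz i j k => cyclic_H_horCurl_eq_zero hO hG hθ hS hZ hω hR hz i j k)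
  have hαc : ∀ j, ContDiffOn ℝ ∞ (fun x => α x (EuclideanSpace.single j 1)) B := fun j =>
    hα.clm_apply contDiffOn_const
  have hαj : ∀ j, ContDiffOn ℝ ∞ (fun z : Phase n => α z.1 (EuclideanSpace.single j 1))
      (B ×ˢ {0}ᶜ) := fun j => (hαc j).comp contDiffOn_fst fun z hz => hz.1
  have hαd : ∀ z ∈ B ×ˢ ({0}ᶜ : Set (Base n)), ∀ j u,
      fderiv ℝ (fun z : Phase n => α z.1 (EuclideanSpace.single j 1)) z u
        = fderiv ℝ α z.1 u.1 (EuclideanSpace.single j 1) := fun z hz j u => by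
    rw [fderiv_comp_fst (A := fun x => α x (EuclideanSpace.single j 1))
      ((hαc j).differentiableAt_of_isOpen hB hz.1),
      fderiv_clm_apply (hα.differentiableAt_of_isOpen hB hz.1) (differentiableAt_const _)]
    simp
  refine ⟨fun j z => θ j z - α z.1 (EuclideanSpace.single j 1), fun j => (hθ j).sub (hαj j),
    fun z hz i j => ?_, fun z hz i j => ?_⟩
  · rw [V_sub hO (hθ j) (hαj j) hz, hθh z hz, V, hαd z hz]
    simp [ddy]
  · rw [horCurl, H_sub hO (hθ j) (hαj j) hz, H_sub hO (hθ i) (hαj i) hz]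
    have h1 := hαω z hz i j
    rw [horCurl] at h1
    have h2 : ∀ i j, H G i (fun z : Phase n => α z.1 (EuclideanSpace.single j 1)) z
        = fderiv ℝ α z.1 (EuclideanSpace.single i 1) (EuclideanSpace.single j 1) := fun i j => by
      rw [H, hαd z hz, horField_fst]
    rw [h2, h2]
    linarith

end LocalExistence

/-! ### Semi-basic 1-forms in coordinates -/

section SemiBasic

variable {D : Set (Phase n)} {z : Phase n} {G : Fin n → Phase n → ℝ}
  {Θ : Phase n → Phase n →L[ℝ] ℝ}

/-- The components `θⱼ = θ(∂/∂xʲ)` of a 1-form in coordinates. -/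
def formComp (Θ : Phase n → Phase n →L[ℝ] ℝ) (j : Fin n) (z : Phase n) : ℝ := Θ z (ddx j)

theorem contDiffOn_formComp (hΘ : ContDiffOn ℝ ∞ Θ D) (j : Fin n) :
    ContDiffOn ℝ ∞ (formComp Θ j) D :=
  hΘ.clm_apply contDiffOn_const

theorem apply_eq_sum_formComp (h : ∀ b, Θ z (0, b) = 0) (v : Phase n) :
    Θ z v = ∑ j, v.1 j * formComp Θ j z := by
  have : v = (∑ j, v.1 j • ddx j) + ((0, v.2) : Phase n) := by
    refine Prod.ext ?_ ?_
    · simpa [Prod.fst_sum, ddx] using base_eq_sum v.1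
    · simp [Prod.snd_sum, ddx]
  conv_lhs => rw [this, map_add, h, add_zero, map_sum]
  simp [formComp]

theorem fderiv_apply_eq_sum_formComp (hD : IsOpen D) (hΘ : ContDiffOn ℝ ∞ Θ D)
    (h : ∀ z ∈ D, ∀ b, Θ z (0, b) = 0) (hz : z ∈ D) (u v : Phase n) :
    fderiv ℝ Θ z u v = ∑ j, v.1 j * fderiv ℝ (formComp Θ j) z u := by
  have h1 : fderiv ℝ (fun w => Θ w v) z u = fderiv ℝ Θ z u v := by
    rw [fderiv_clm_apply (hΘ.differentiableAt_of_isOpen hD hz) (differentiableAt_const v)]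
    simp
  have h2 : Set.EqOn (fun w => Θ w v) (fun w => ∑ j, v.1 j * formComp Θ j w) D :=
    fun w hw => apply_eq_sum_formComp (h w hw) v
  rw [← h1, h2.fderiv_eq_of_isOpen hD hz, fderiv_sum_mul (fun j => differentiableAt_const _)
    (fun j => (contDiffOn_formComp hΘ j).differentiableAt_of_isOpen hD hz)]
  simp

theorem extD_eq_sum (hD : IsOpen D) (hΘ : ContDiffOn ℝ ∞ Θ D)
    (h : ∀ z ∈ D, ∀ b, Θ z (0, b) = 0) (hz : z ∈ D) (u v : Phase n) :
    extD Θ z u v = (∑ j, v.1 j * fderiv ℝ (formComp Θ j) z u)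
      - ∑ j, u.1 j * fderiv ℝ (formComp Θ j) z v := by
  rw [extD, fderiv_apply_eq_sum_formComp hD hΘ h hz, fderiv_apply_eq_sum_formComp hD hΘ h hz]

theorem lieD_liouville_eq (hD : IsOpen D) (hΘ : ContDiffOn ℝ ∞ Θ D)
    (h : ∀ z ∈ D, ∀ b, Θ z (0, b) = 0) (hz : z ∈ D) (v : Phase n) :
    lieD liouville Θ z v = ∑ j, v.1 j * ∑ k, z.2 k * V k (formComp Θ j) z := by
  have h1 : HasFDerivAt (liouville : Phase n → Phase n)
      ((0 : Phase n →L[ℝ] Base n).prod (ContinuousLinearMap.snd ℝ (Base n) (Base n))) z :=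
    (hasFDerivAt_const 0 z).prodMk hasFDerivAt_snd
  rw [lieD, h1.fderiv, fderiv_apply_eq_sum_formComp hD hΘ h hz]
  simp only [ContinuousLinearMap.prod_apply, zero_apply, ContinuousLinearMap.coe_snd', h z hz,
    add_zero, liouville, fderiv_vertical_eq_sum]

theorem tangentStructure_apply (z u : Phase n) : tangentStructure z u = (0, u.1) := by
  simp only [tangentStructure, sum_apply, ContinuousLinearMap.smulRight_apply]
  refine Prod.ext ?_ ?_
  · simp [Prod.fst_sum, ddy]
  · simpa [Prod.snd_sum, ddy, dx] using (base_eq_sum u.1).symm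

theorem horProj_apply (z u : Phase n) : horProj G z u = ∑ i, u.1 i • horField G i z := by
  simp [horProj, sum_apply, dx]

theorem horProj_fst (z u : Phase n) : (horProj G z u).1 = u.1 := by
  rw [horProj_apply, Prod.fst_sum]
  simpa [horField_fst] using (base_eq_sum u.1).symm

/-- The components of `d_J θ` for a semi-basic 1-form are `Vᵢ(θⱼ) - Vⱼ(θᵢ)`. -/
theorem extDAlong_tangentStructure_eq (hD : IsOpen D) (hΘ : ContDiffOn ℝ ∞ Θ D)
    (h : ∀ z ∈ D, ∀ b, Θ z (0, b) = 0) (hz : z ∈ D) (u v : Phase n) :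
    extDAlong tangentStructure Θ z u v
      = ∑ i, ∑ j, u.1 i * v.1 j * (V i (formComp Θ j) z - V j (formComp Θ i) z) := by
  have h0 : Set.EqOn (fun w => (Θ w).comp (tangentStructure w)) (fun _ => 0) D := fun w hw => by
    refine ContinuousLinearMap.ext fun v => ?_
    rw [ContinuousLinearMap.comp_apply, tangentStructure_apply, h w hw]
    rfl
  have h1 : extD (fun w => (Θ w).comp (tangentStructure w)) z u v = 0 := by
    rw [extD, h0.fderiv_eq_of_isOpen hD hz]
    simp
  rw [extDAlong, h1, extD_eq_sum hD hΘ h hz, extD_eq_sum hD hΘ h hz]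
  simp only [tangentStructure_apply, fderiv_vertical_eq_sum, PiLp.zero_apply, zero_mul,
    Finset.sum_const_zero, sub_zero, zero_sub, mul_sub, Finset.sum_sub_distrib, Finset.mul_sum]
  rw [← sub_eq_add_neg]
  congr 1
  · rw [Finset.sum_comm]
    exact Finset.sum_congr rfl fun i _ => Finset.sum_congr rfl fun j _ => by ring
  · exact Finset.sum_congr rfl fun i _ => Finset.sum_congr rfl fun j _ => by ring

/-- The components of `d_H θ` for a semi-basic 1-form are `Hᵢ(θⱼ) - Hⱼ(θᵢ)`. -/
theorem extDAlong_horProj_eq (hD : IsOpen D) (hΘ : ContDiffOn ℝ ∞ Θ D)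
    (h : ∀ z ∈ D, ∀ b, Θ z (0, b) = 0) (hz : z ∈ D) (u v : Phase n) :
    extDAlong (horProj G) Θ z u v
      = ∑ i, ∑ j, u.1 i * v.1 j * horCurl G (formComp Θ) i j z := by
  have h0 : Set.EqOn (fun w => (Θ w).comp (horProj G w)) Θ D := fun w hw => by
    refine ContinuousLinearMap.ext fun v => ?_
    rw [ContinuousLinearMap.comp_apply, apply_eq_sum_formComp (h w hw),
      apply_eq_sum_formComp (h w hw) v, horProj_fst]
  have h1 : extD (fun w => (Θ w).comp (horProj G w)) z u v = extD Θ z u v := by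
    rw [extD, extD, h0.fderiv_eq_of_isOpen hD hz]
  have h2 : ∀ (f : Phase n → ℝ) (u : Phase n),
      fderiv ℝ f z (horProj G z u) = ∑ i, u.1 i * H G i f z := fun f u => by
    rw [horProj_apply, map_sum]
    simp [H]
  have h3 : ∑ i, ∑ j, u.1 i * v.1 j * horCurl G (formComp Θ) i j z
      = (∑ j, v.1 j * ∑ i, u.1 i * H G i (formComp Θ j) z)
        - ∑ i, u.1 i * ∑ j, v.1 j * H G j (formComp Θ i) z := by
    simp only [horCurl, mul_sub, Finset.sum_sub_distrib, Finset.mul_sum]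
    congr 1
    · rw [Finset.sum_comm]
      exact Finset.sum_congr rfl fun i _ => Finset.sum_congr rfl fun j _ => by ring
    · exact Finset.sum_congr rfl fun i _ => Finset.sum_congr rfl fun j _ => by ring
  rw [extDAlong, h1, extD_eq_sum hD hΘ h hz, extD_eq_sum hD hΘ h hz, extD_eq_sum hD hΘ h hz, h3]
  simp only [horProj_fst, h2]
  ring

/-- For a semi-basic 1-form with `L_Δ θ = 0` and `d_J θ = 0`, the contraction of `dθ` with the
spray is the contraction of `d_H θ` with `y`. -/
theorem extD_spray_eq (hD : IsOpen D) (hΘ : ContDiffOn ℝ ∞ Θ D)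
    (h : ∀ z ∈ D, ∀ b, Θ z (0, b) = 0)
    (hE : ∀ z ∈ D, ∀ i, ∑ k, z.2 k * V k (G i) z = 2 * G i z)
    (hS : ∀ z ∈ D, ∀ i j, V i (formComp Θ j) z = V j (formComp Θ i) z)
    (hZ : ∀ z ∈ D, ∀ j, ∑ k, z.2 k * V k (formComp Θ j) z = 0)
    (hz : z ∈ D) {S : Phase n} (h1 : S.1 = z.2) (h2 : ∀ i, S.2 i = -2 * G i z) (v : Phase n) :
    extD Θ z S v = ∑ j, v.1 j * ∑ k, z.2 k * horCurl G (formComp Θ) k j z := by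
  -- Modulo vertical vectors, which `yᵏ dθₖ` annihilates, `v` is its horizontal part.
  have hvert : ∀ b, ∑ k, z.2 k * fderiv ℝ (formComp Θ k) z (0, b) = 0 := fun b => by
    simp only [fderiv_vertical_eq_sum, Finset.mul_sum]
    rw [Finset.sum_comm]
    refine Finset.sum_eq_zero fun m _ => ?_
    have := congrArg (b m * ·) (hZ z hz m)
    simp only [Finset.mul_sum, mul_zero] at this
    rw [← this]
    exact Finset.sum_congr rfl fun k _ => by rw [hS z hz m k]; ring
  have hv : v = horProj G z v + ((0, (v - horProj G z v).2) : Phase n) := by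
    refine Prod.ext ?_ ?_
    · simp [horProj_fst]
    · simp
  have h3 : ∑ k, z.2 k * fderiv ℝ (formComp Θ k) z v
      = ∑ k, z.2 k * ∑ j, v.1 j * H G j (formComp Θ k) z := by
    conv_lhs =>
      enter [2, k]
      rw [hv, map_add, mul_add]
    rw [Finset.sum_add_distrib, hvert, add_zero]
    refine Finset.sum_congr rfl fun k _ => ?_
    rw [horProj_apply, map_sum]
    simp [H]
  rw [extD_eq_sum hD hΘ h hz, h1, h3]
  simp only [fderiv_spray_eq_sum_H hE hz h1 h2, horCurl, mul_sub, Finset.sum_sub_distrib,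
    Finset.mul_sum]
  congr 1
  rw [Finset.sum_comm]
  exact Finset.sum_congr rfl fun i _ => Finset.sum_congr rfl fun j _ => by ring

end SemiBasic

/-! ### Pullbacks of 1-forms -/

section Pullback

variable {D D' : Set (Phase n)} {z : Phase n} {Θ Θ' : Phase n → Phase n →L[ℝ] ℝ}
  {φ : Phase n → Phase n}

theorem contDiffOn_of_pullback (hD' : IsOpen D') (hΘ : ContDiffOn ℝ ∞ Θ D)
    (hφ : ContDiffOn ℝ ∞ φ D') (hm : Set.MapsTo φ D' D)
    (hp : ∀ z ∈ D', Θ' z = (Θ (φ z)).comp (fderiv ℝ φ z)) : ContDiffOn ℝ ∞ Θ' D' :=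
  ((hΘ.comp hφ hm).clm_comp ((contDiffOn_infty_iff_fderiv_of_isOpen hD').1 hφ).2).congr hp

/-- The exterior derivative commutes with pullback. -/
theorem extD_pullback (hD : IsOpen D) (hD' : IsOpen D') (hΘ : ContDiffOn ℝ ∞ Θ D)
    (hφ : ContDiffOn ℝ ∞ φ D') (hm : Set.MapsTo φ D' D)
    (hp : ∀ z ∈ D', Θ' z = (Θ (φ z)).comp (fderiv ℝ φ z)) (hz : z ∈ D') (u v : Phase n) :
    extD Θ' z u v = extD Θ (φ z) (fderiv ℝ φ z u) (fderiv ℝ φ z v) := by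
  have hΘ' := contDiffOn_of_pullback hD' hΘ hφ hm hp
  have hΘz := (hΘ.differentiableAt_of_isOpen hD (hm hz)).hasFDerivAt
  have hφz := (hφ.differentiableAt_of_isOpen hD' hz).hasFDerivAt
  have hc : HasFDerivAt (fun w => Θ (φ w)) _ z := HasFDerivAt.comp (g := Θ) z hΘz hφz
  have key : ∀ u v, fderiv ℝ Θ' z u v
      = fderiv ℝ Θ (φ z) (fderiv ℝ φ z u) (fderiv ℝ φ z v)
        + Θ (φ z) (fderiv ℝ (fderiv ℝ φ) z u v) := by
    intro u v
    have h1 : fderiv ℝ (fun w => Θ' w v) z u = fderiv ℝ Θ' z u v := by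
      rw [fderiv_clm_apply (hΘ'.differentiableAt_of_isOpen hD' hz) (differentiableAt_const v)]
      simp
    have h2 : Set.EqOn (fun w => Θ' w v) (fun w => Θ (φ w) (fderiv ℝ φ w v)) D' := fun w hw => by
      simp [hp w hw]
    have hdv : DifferentiableAt ℝ (fun w => fderiv ℝ φ w v) z :=
      (hφ.fderiv_along hD' contDiffOn_const).differentiableAt_of_isOpen hD' hz
    rw [← h1, h2.fderiv_eq_of_isOpen hD' hz, fderiv_clm_apply hc.differentiableAt hdv, hc.fderiv]
    simp [fderiv_fderiv_const hD' hφ hz, add_comm]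
  rw [extD, key, key, extD, fderiv_fderiv_comm hD' hφ hz v u]
  ring

/-- The transition map `(x, y) ↦ (f x, Df(x) y)` of induced coordinates. -/
def tangentTransition (f : Base n → Base n) (z : Phase n) : Phase n := (f z.1, fderiv ℝ f z.1 z.2)

variable {f : Base n → Base n} {O : Set (Base n)}

theorem contDiffOn_tangentTransition (hO : IsOpen O) (hf : ContDiffOn ℝ ∞ f O) :
    ContDiffOn ℝ ∞ (tangentTransition f) (Prod.fst ⁻¹' O) :=
  (hf.comp contDiffOn_fst fun _ hz => hz).prodMk
    ((((contDiffOn_infty_iff_fderiv_of_isOpen hO).1 hf).2.comp contDiffOn_fst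
      fun _ hz => hz).clm_apply contDiffOn_snd)

theorem fderiv_tangentTransition_fst (hO : IsOpen O) (hf : ContDiffOn ℝ ∞ f O) (hz : z.1 ∈ O)
    (u : Phase n) : (fderiv ℝ (tangentTransition f) z u).1 = fderiv ℝ f z.1 u.1 := by
  have h1 := ((contDiffOn_tangentTransition hO hf).differentiableAt_of_isOpen
    (hO.preimage continuous_fst) hz).hasFDerivAt.fst
  have h2 : HasFDerivAt (fun w : Phase n => f w.1) _ z := HasFDerivAt.comp (g := f) z
    (hf.differentiableAt_of_isOpen hO hz).hasFDerivAt hasFDerivAt_fst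
  exact congrArg (fun T : Phase n →L[ℝ] Base n => T u) (h1.unique h2)

theorem pullback_tangentTransition_apply (hO : IsOpen O) (hf : ContDiffOn ℝ ∞ f O) (hz : z.1 ∈ O)
    (hsb : ∀ b, Θ (tangentTransition f z) (0, b) = 0)
    (hp : Θ' z = (Θ (tangentTransition f z)).comp (fderiv ℝ (tangentTransition f) z))
    (u : Phase n) : Θ' z u = Θ (tangentTransition f z) (fderiv ℝ f z.1 u.1, 0) := by
  have h : fderiv ℝ (tangentTransition f) z u
      = (fderiv ℝ f z.1 u.1, 0) + ((0, (fderiv ℝ (tangentTransition f) z u).2) : Phase n) := by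
    refine Prod.ext ?_ ?_
    · simp [fderiv_tangentTransition_fst hO hf hz]
    · simp
  rw [hp, ContinuousLinearMap.comp_apply, h, map_add, hsb, add_zero]

/-- The vertical derivative of a semi-basic 1-form is tensorial: it transforms under changes of
induced coordinates as a type (0,2) tensor along the projection. -/
theorem vertDeriv_pullback (hD : IsOpen D) (hD' : IsOpen D') (hO : IsOpen O)
    (hf : ContDiffOn ℝ ∞ f O) (hD'O : ∀ z ∈ D', z.1 ∈ O) (hΘ : ContDiffOn ℝ ∞ Θ D)
    (hm : Set.MapsTo (tangentTransition f) D' D)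
    (hsb : ∀ z ∈ D, ∀ b, Θ z (0, b) = 0)
    (hp : ∀ z ∈ D', Θ' z = (Θ (tangentTransition f z)).comp (fderiv ℝ (tangentTransition f) z))
    (hz : z ∈ D') (a b : Base n) :
    fderiv ℝ Θ' z (0, b) (a, 0)
      = fderiv ℝ Θ (tangentTransition f z) (0, fderiv ℝ f z.1 b) (fderiv ℝ f z.1 a, 0) := by
  have hφ : ContDiffOn ℝ ∞ (tangentTransition f) D' :=
    (contDiffOn_tangentTransition hO hf).mono hD'O
  have hΘ' := contDiffOn_of_pullback hD' hΘ hφ hm hp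
  have h1 : HasFDerivAt (fun y => Θ' (z.1, y))
      ((fderiv ℝ Θ' z).comp (ContinuousLinearMap.inr ℝ (Base n) (Base n))) z.2 :=
    HasFDerivAt.comp (g := Θ') z.2 (hΘ'.differentiableAt_of_isOpen hD' hz).hasFDerivAt
      (hasFDerivAt_prodMk_right z.1 z.2)
  have h1' := h1.clm_apply (hasFDerivAt_const ((a, 0) : Phase n) z.2)
  have h2 : HasFDerivAt (fun y => ((f z.1, fderiv ℝ f z.1 y) : Phase n))
      ((ContinuousLinearMap.inr ℝ (Base n) (Base n)).comp (fderiv ℝ f z.1)) z.2 :=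
    (hasFDerivAt_prodMk_right _ _).comp z.2 (fderiv ℝ f z.1).hasFDerivAt
  have h3 : HasFDerivAt (fun y => Θ (f z.1, fderiv ℝ f z.1 y)) _ z.2 :=
    HasFDerivAt.comp (g := Θ) z.2
      (hΘ.differentiableAt_of_isOpen hD (hm hz)).hasFDerivAt h2
  have h3' := h3.clm_apply (hasFDerivAt_const ((fderiv ℝ f z.1 a, 0) : Phase n) z.2)
  have he : (fun y => Θ' (z.1, y) (a, 0)) =ᶠ[nhds z.2]
      fun y => Θ (f z.1, fderiv ℝ f z.1 y) (fderiv ℝ f z.1 a, 0) := by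
    have hn : ∀ᶠ y in nhds z.2, (z.1, y) ∈ D' :=
      (Continuous.prodMk_right z.1).continuousAt.eventually_mem (hD'.mem_nhds hz)
    filter_upwards [hn] with y hy
    exact pullback_tangentTransition_apply (z := (z.1, y)) hO hf (hD'O z hz) (hsb _ (hm hy))
      (hp _ hy) (a, 0)
  have := congrArg (fun T : Base n →L[ℝ] ℝ => T b) (h1'.unique (h3'.congr_of_eventuallyEq he))
  simpa using this

end Pullback

/-! ### Induced coordinates on the tangent bundle -/

section Charts

open Bundle

variable {M : Type*} [TopologicalSpace M] {e e' : OpenPartialHomeomorph M (Base n)} {z : Phase n}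
  {U : Set M}

/-- The transition map between two charts of `M`. -/
def chartTransition (e e' : OpenPartialHomeomorph M (Base n)) : Base n → Base n := e' ∘ e.symm

/-- The domain of the transition map between two charts of `M`. -/
def transitionDomain (e e' : OpenPartialHomeomorph M (Base n)) : Set (Base n) :=
  e.target ∩ e.symm ⁻¹' e'.source

theorem isOpen_transitionDomain (e e' : OpenPartialHomeomorph M (Base n)) :
    IsOpen (transitionDomain e e') :=
  e.isOpen_inter_preimage_symm e'.open_source

theorem eventually_mem_transitionDomain (hz : z.1 ∈ transitionDomain e e') :
    ∀ᶠ w : Phase n in nhds z, w.1 ∈ transitionDomain e e' :=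
  ((isOpen_transitionDomain e e').preimage continuous_fst).mem_nhds hz

theorem mem_slitDomain_univ (hz : z ∈ slitDomain U e) : z ∈ slitDomain Set.univ e :=
  ⟨hz.1, trivial, hz.2.2⟩

theorem isOpen_slitDomain (hU : IsOpen U) (e : OpenPartialHomeomorph M (Base n)) :
    IsOpen (slitDomain U e) := by
  have h1 : IsOpen (e.target ∩ e.symm ⁻¹' U) := e.isOpen_inter_preimage_symm hU
  have h2 := (h1.preimage (continuous_fst (Y := Base n))).inter
    ((isOpen_compl_singleton (x := (0 : Base n))).preimage (continuous_snd (X := Base n)))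
  convert h2 using 1
  ext z
  simp [slitDomain, and_assoc]

variable [ChartedSpace (Base n) M]

theorem mdifferentiable_of_mem_maximalAtlas (he : e ∈ IsManifold.maximalAtlas (𝓡 n) ∞ M) :
    e.MDifferentiable (𝓡 n) (𝓡 n) :=
  ⟨(contMDiffOn_of_mem_maximalAtlas he).mdifferentiableOn (by simp),
    (contMDiffOn_symm_of_mem_maximalAtlas he).mdifferentiableOn (by simp)⟩

theorem contDiffOn_chartTransition (he : e ∈ IsManifold.maximalAtlas (𝓡 n) ∞ M)
    (he' : e' ∈ IsManifold.maximalAtlas (𝓡 n) ∞ M) :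
    ContDiffOn ℝ ∞ (chartTransition e e') (transitionDomain e e') :=
  contMDiffOn_iff_contDiffOn.1 <| (contMDiffOn_of_mem_maximalAtlas he').comp
    ((contMDiffOn_symm_of_mem_maximalAtlas he).mono Set.inter_subset_left) fun _ hx => hx.2

theorem mfderiv_chart_symm_apply (he : e ∈ IsManifold.maximalAtlas (𝓡 n) ∞ M) {x : Base n}
    (hx : x ∈ e.target) (v : Base n) :
    mfderiv (𝓡 n) (𝓡 n) e (e.symm x) (mfderiv (𝓡 n) (𝓡 n) e.symm x v) = v :=
  congrArg (fun T : Base n →L[ℝ] Base n => T v)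
    ((mdifferentiable_of_mem_maximalAtlas he).comp_symm_deriv hx)

theorem mfderiv_symm_chart_apply (he : e ∈ IsManifold.maximalAtlas (𝓡 n) ∞ M) {p : M}
    (hp : p ∈ e.source) (v : TangentSpace (𝓡 n) p) :
    mfderiv (𝓡 n) (𝓡 n) e.symm (e p) (mfderiv (𝓡 n) (𝓡 n) e p v) = v :=
  congrArg (fun T : Base n →L[ℝ] Base n => T v)
    ((mdifferentiable_of_mem_maximalAtlas he).symm_comp_deriv hp)

theorem fderiv_chartTransition (he : e ∈ IsManifold.maximalAtlas (𝓡 n) ∞ M)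
    (he' : e' ∈ IsManifold.maximalAtlas (𝓡 n) ∞ M) {x : Base n}
    (hx : x ∈ transitionDomain e e') (v : Base n) :
    fderiv ℝ (chartTransition e e') x v
      = mfderiv (𝓡 n) (𝓡 n) e' (e.symm x) (mfderiv (𝓡 n) (𝓡 n) e.symm x v) := by
  rw [← mfderiv_eq_fderiv]
  exact mfderiv_comp_apply x
    ((mdifferentiable_of_mem_maximalAtlas he').mdifferentiableAt hx.2)
    ((mdifferentiable_of_mem_maximalAtlas he).mdifferentiableAt_symm hx.1) v

theorem Multiplier.congr_point (h : Multiplier n M) {q q' : TangentBundle (𝓡 n) M} (hq : q = q')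
    (u v : Base n) : (h q : LinearMap.BilinForm ℝ (Base n)) u v
      = (h q' : LinearMap.BilinForm ℝ (Base n)) u v := by
  subst hq; rfl

/-- The components of a tensor field along the projection determine it. -/
theorem Multiplier.apply_eq_sum (h : Multiplier n M) (e : OpenPartialHomeomorph M (Base n))
    (z : Phase n) (a b : Base n) :
    (h (param e z) : LinearMap.BilinForm ℝ (Base n)) (mfderiv (𝓡 n) (𝓡 n) e.symm z.1 a)
        (mfderiv (𝓡 n) (𝓡 n) e.symm z.1 b)
      = ∑ l, ∑ k, a l * b k * h.comp e l k z := by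
  let B : LinearMap.BilinForm ℝ (Base n) := h (param e z)
  let T : Base n →L[ℝ] Base n := mfderiv (𝓡 n) (𝓡 n) e.symm z.1
  change B (T a) (T b) = ∑ l, ∑ k, a l * b k
    * B (T (EuclideanSpace.single l 1)) (T (EuclideanSpace.single k 1))
  conv_lhs => rw [base_eq_sum a, base_eq_sum b]
  simp only [map_sum, map_smul, LinearMap.sum_apply, LinearMap.smul_apply, smul_eq_mul,
    Finset.mul_sum]
  rw [Finset.sum_comm]
  exact Finset.sum_congr rfl fun l _ => Finset.sum_congr rfl fun k _ => by ring

theorem coords_param (he : e ∈ IsManifold.maximalAtlas (𝓡 n) ∞ M) (hz : z.1 ∈ e.target) :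
    coords e (param e z) = z :=
  Prod.ext (e.right_inv hz) (mfderiv_chart_symm_apply he hz z.2)

theorem param_coords (he : e ∈ IsManifold.maximalAtlas (𝓡 n) ∞ M) {q : TangentBundle (𝓡 n) M}
    (hq : q.proj ∈ e.source) : param e (coords e q) = q := by
  obtain ⟨p, v⟩ := q
  have h1 : e.symm (e p) = p := e.left_inv hq
  have h2 := mfderiv_symm_chart_apply he hq v
  exact TotalSpace.ext h1 (heq_of_eq h2)

theorem coords_param_eq_tangentTransition (he : e ∈ IsManifold.maximalAtlas (𝓡 n) ∞ M)
    (he' : e' ∈ IsManifold.maximalAtlas (𝓡 n) ∞ M) (hz : z.1 ∈ transitionDomain e e') :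
    coords e' (param e z) = tangentTransition (chartTransition e e') z :=
  Prod.ext rfl (fderiv_chartTransition he he' hz z.2).symm

theorem param_tangentTransition (he : e ∈ IsManifold.maximalAtlas (𝓡 n) ∞ M)
    (he' : e' ∈ IsManifold.maximalAtlas (𝓡 n) ∞ M) (hz : z.1 ∈ transitionDomain e e') :
    param e' (tangentTransition (chartTransition e e') z) = param e z := by
  rw [← coords_param_eq_tangentTransition he he' hz]
  exact param_coords he' hz.2

theorem mfderiv_symm_fderiv_chartTransition (he : e ∈ IsManifold.maximalAtlas (𝓡 n) ∞ M)
    (he' : e' ∈ IsManifold.maximalAtlas (𝓡 n) ∞ M) {x : Base n}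
    (hx : x ∈ transitionDomain e e') (v : Base n) :
    (mfderiv (𝓡 n) (𝓡 n) e'.symm (chartTransition e e' x)
        (fderiv ℝ (chartTransition e e') x v) : Base n)
      = mfderiv (𝓡 n) (𝓡 n) e.symm x v := by
  rw [fderiv_chartTransition he he' hx]
  exact mfderiv_symm_chart_apply he' hx.2 _

theorem param_snd_ne_zero (he : e ∈ IsManifold.maximalAtlas (𝓡 n) ∞ M)
    (hz : z ∈ slitDomain U e) : (param e z).2 ≠ 0 := by
  intro h
  have h1 := mfderiv_chart_symm_apply he hz.1 z.2
  have h2 : (mfderiv (𝓡 n) (𝓡 n) e.symm z.1 z.2 : Base n) = 0 := h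
  refine hz.2.2 (h1.symm.trans ?_)
  exact (congrArg (mfderiv (𝓡 n) (𝓡 n) e (e.symm z.1) : Base n →L[ℝ] Base n) h2).trans
    (map_zero (mfderiv (𝓡 n) (𝓡 n) e (e.symm z.1) : Base n →L[ℝ] Base n))

theorem tangentTransition_mem_slitDomain (he : e ∈ IsManifold.maximalAtlas (𝓡 n) ∞ M)
    (he' : e' ∈ IsManifold.maximalAtlas (𝓡 n) ∞ M) (hz : z ∈ slitDomain U e)
    (hz' : z.1 ∈ transitionDomain e e') :
    tangentTransition (chartTransition e e') z ∈ slitDomain U e' := by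
  refine ⟨e'.map_source hz'.2, ?_, fun h => ?_⟩
  · change e'.symm (e' (e.symm z.1)) ∈ U
    rw [e'.left_inv hz'.2]
    exact hz.2.1
  · have h1 := mfderiv_symm_fderiv_chartTransition he he' hz' z.2
    have h2 : fderiv ℝ (chartTransition e e') z.1 z.2 = 0 := h
    rw [h2] at h1
    refine param_snd_ne_zero he hz (h1.symm.trans ?_)
    exact map_zero (mfderiv (𝓡 n) (𝓡 n) e'.symm (chartTransition e e' z.1) :
      Base n →L[ℝ] Base n)

variable [IsManifold (𝓡 n) ∞ M]

theorem contMDiff_toTangentBundle :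
    ContMDiff 𝓘(ℝ, Phase n) (𝓡 n).tangent ∞
      (fun z : Phase n => (⟨z.1, z.2⟩ : TangentBundle (𝓡 n) (Base n))) := by
  have := contMDiff_tangentBundleModelSpaceHomeomorph_symm (I := 𝓡 n) (n := ∞)
  rw [modelWithCornersSelf_prod]
  exact this

theorem contMDiff_ofTangentBundle :
    ContMDiff (𝓡 n).tangent 𝓘(ℝ, Phase n) ∞
      (fun q : TangentBundle (𝓡 n) (Base n) => ((q.1, q.2) : Phase n)) := by
  have := contMDiff_tangentBundleModelSpaceHomeomorph (I := 𝓡 n) (n := ∞)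
  rw [modelWithCornersSelf_prod]
  exact this

theorem contMDiffOn_param (he : e ∈ IsManifold.maximalAtlas (𝓡 n) ∞ M) :
    ContMDiffOn 𝓘(ℝ, Phase n) (𝓡 n).tangent ∞ (param e) (Prod.fst ⁻¹' e.target) := by
  have h := (contMDiffOn_symm_of_mem_maximalAtlas he).contMDiffOn_tangentMapWithin (m := ∞)
    (by simp) e.open_target.uniqueMDiffOn
  refine (h.comp contMDiff_toTangentBundle.contMDiffOn (s := Prod.fst ⁻¹' e.target)
    fun z hz => hz).congr fun z hz => ?_
  simp only [Function.comp_apply, tangentMapWithin, param]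
  rw [mfderivWithin_of_isOpen e.open_target hz]

theorem contMDiffOn_coords (he : e ∈ IsManifold.maximalAtlas (𝓡 n) ∞ M) :
    ContMDiffOn (𝓡 n).tangent 𝓘(ℝ, Phase n) ∞ (coords e)
      ((TotalSpace.proj : TangentBundle (𝓡 n) M → M) ⁻¹' e.source) := by
  have h := (contMDiffOn_of_mem_maximalAtlas he).contMDiffOn_tangentMapWithin (m := ∞)
    (by simp) e.open_source.uniqueMDiffOn
  refine (contMDiff_ofTangentBundle.comp_contMDiffOn h).congr fun q hq => ?_
  simp only [Function.comp_apply, tangentMapWithin, coords]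
  rw [mfderivWithin_of_isOpen e.open_source hq]

theorem mdifferentiableAt_param (he : e ∈ IsManifold.maximalAtlas (𝓡 n) ∞ M)
    (hz : z.1 ∈ e.target) :
    MDifferentiableAt 𝓘(ℝ, Phase n) (𝓡 n).tangent (param e) z :=
  ((contMDiffOn_param he).contMDiffAt
    ((e.open_target.preimage continuous_fst).mem_nhds hz)).mdifferentiableAt (by simp)

theorem isOpen_proj_preimage {s : Set M} (hs : IsOpen s) :
    IsOpen ((TotalSpace.proj : TangentBundle (𝓡 n) M → M) ⁻¹' s) :=
  hs.preimage (FiberBundle.continuous_proj _ _)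

theorem mdifferentiableAt_coords (he : e ∈ IsManifold.maximalAtlas (𝓡 n) ∞ M)
    {q : TangentBundle (𝓡 n) M} (hq : q.proj ∈ e.source) :
    MDifferentiableAt (𝓡 n).tangent 𝓘(ℝ, Phase n) (coords e) q :=
  ((contMDiffOn_coords he).contMDiffAt
    ((isOpen_proj_preimage e.open_source).mem_nhds hq)).mdifferentiableAt (by simp)

theorem mdifferentiableAt_proj (q : TangentBundle (𝓡 n) M) :
    MDifferentiableAt (𝓡 n).tangent (𝓡 n) (TotalSpace.proj : TangentBundle (𝓡 n) M → M) q :=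
  (Bundle.contMDiff_proj (n := 1) (TangentSpace (𝓡 n) : M → Type _)).mdifferentiableAt (by simp)

/-! ### Coordinate expressions under changes of charts -/

theorem TOneForm.congr_point (θ : TOneForm n M) {q q' : TangentBundle (𝓡 n) M} (h : q = q')
    (v : Phase n) : (θ q : Phase n →L[ℝ] ℝ) v = (θ q' : Phase n →L[ℝ] ℝ) v := by
  subst h; rfl

/-- The coordinate expressions of a 1-form are related by pullback. -/
theorem TOneForm.inChart_eq (he : e ∈ IsManifold.maximalAtlas (𝓡 n) ∞ M)
    (he' : e' ∈ IsManifold.maximalAtlas (𝓡 n) ∞ M) (hz : z.1 ∈ transitionDomain e e')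
    (θ : TOneForm n M) :
    θ.inChart e z = (θ.inChart e' (tangentTransition (chartTransition e e') z)).comp
      (fderiv ℝ (tangentTransition (chartTransition e e')) z) := by
  set φ := tangentTransition (chartTransition e e') with hφ
  have hd : DifferentiableAt ℝ φ z :=
    (contDiffOn_tangentTransition (isOpen_transitionDomain e e')
      (contDiffOn_chartTransition he he')).differentiableAt_of_isOpen
        ((isOpen_transitionDomain e e').preimage continuous_fst) hz
  have h1 : param e =ᶠ[nhds z] param e' ∘ φ := by
    filter_upwards [eventually_mem_transitionDomain hz] with w hw
    exact (param_tangentTransition he he' hw).symm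
  have hφz : (φ z).1 ∈ e'.target := e'.map_source hz.2
  refine ContinuousLinearMap.ext fun v => ?_
  have h2 : (mfderiv 𝓘(ℝ, Phase n) (𝓡 n).tangent (param e) z v : Phase n)
      = mfderiv 𝓘(ℝ, Phase n) (𝓡 n).tangent (param e') (φ z) (fderiv ℝ φ z v) := by
    rw [← mfderiv_eq_fderiv]
    refine Eq.trans ?_ (mfderiv_comp_apply z (mdifferentiableAt_param he' hφz)
      hd.mdifferentiableAt v)
    exact congrArg (fun T : Phase n →L[ℝ] Phase n => T v) h1.mfderiv_eq
  have h3 := θ.congr_point (param_tangentTransition he he' hz)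
    (mfderiv 𝓘(ℝ, Phase n) (𝓡 n).tangent (param e) z v)
  refine h3.symm.trans ?_
  exact congrArg (θ (param e' (φ z)) : Phase n →L[ℝ] ℝ) h2

/-- The coordinate expressions of a vector field are related by pushforward. -/
theorem TVectorField.inChart_eq (he : e ∈ IsManifold.maximalAtlas (𝓡 n) ∞ M)
    (he' : e' ∈ IsManifold.maximalAtlas (𝓡 n) ∞ M) (hz : z.1 ∈ transitionDomain e e')
    (X : TVectorField n M) :
    X.inChart e' (tangentTransition (chartTransition e e') z)
      = fderiv ℝ (tangentTransition (chartTransition e e')) z (X.inChart e z) := by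
  set φ := tangentTransition (chartTransition e e') with hφ
  have hd : DifferentiableAt ℝ φ z :=
    (contDiffOn_tangentTransition (isOpen_transitionDomain e e')
      (contDiffOn_chartTransition he he')).differentiableAt_of_isOpen
        ((isOpen_transitionDomain e e').preimage continuous_fst) hz
  set q := param e z with hq
  have hqe : q.proj ∈ e.source := e.map_target hz.1
  have hcq : coords e q = z := coords_param he hz.1
  have h1 : coords e' =ᶠ[nhds q] φ ∘ coords e := by
    have ho := (isOpen_proj_preimage (n := n) (e.open_source.inter e'.open_source)).mem_nhds
      (show q ∈ _ from ⟨hqe, hz.2⟩)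
    filter_upwards [ho] with r hr
    have hr' : (coords e r).1 ∈ transitionDomain e e' :=
      ⟨e.map_source hr.1, by
        change e.symm (e r.proj) ∈ e'.source
        rw [e.left_inv hr.1]
        exact hr.2⟩
    have := coords_param_eq_tangentTransition he he' hr'
    rwa [param_coords he hr.1] at this
  have hd' : DifferentiableAt ℝ φ (coords e q) := by rwa [hcq]
  have h2 : ∀ v : Phase n, (mfderiv (𝓡 n).tangent 𝓘(ℝ, Phase n) (coords e') q v : Phase n)
      = fderiv ℝ φ z (mfderiv (𝓡 n).tangent 𝓘(ℝ, Phase n) (coords e) q v) := fun v => by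
    have h3 := mfderiv_comp_apply q hd'.mdifferentiableAt (mdifferentiableAt_coords he hqe) v
    rw [mfderiv_eq_fderiv, hcq] at h3
    refine Eq.trans ?_ h3
    exact congrArg (fun T : Phase n →L[ℝ] Phase n => T v) h1.mfderiv_eq
  have h4 : param e' (φ z) = q := param_tangentTransition he he' hz
  refine Eq.trans ?_ (h2 (X q))
  rw [TVectorField.inChart]
  have key : ∀ r : TangentBundle (𝓡 n) M, r = q →
      (mfderiv (𝓡 n).tangent 𝓘(ℝ, Phase n) (coords e') r (X r) : Phase n)
        = mfderiv (𝓡 n).tangent 𝓘(ℝ, Phase n) (coords e') q (X q) := by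
    rintro r rfl; rfl
  exact key _ h4

theorem mfderiv_proj_mfderiv_param (he : e ∈ IsManifold.maximalAtlas (𝓡 n) ∞ M)
    (hz : z.1 ∈ e.target) (v : Phase n) :
    (mfderiv (𝓡 n).tangent (𝓡 n) (TotalSpace.proj : TangentBundle (𝓡 n) M → M) (param e z)
      (mfderiv 𝓘(ℝ, Phase n) (𝓡 n).tangent (param e) z v) : Base n)
      = mfderiv (𝓡 n) (𝓡 n) e.symm z.1 v.1 := by
  have h1 := mfderiv_comp_apply z (mdifferentiableAt_proj (param e z))
    (mdifferentiableAt_param he hz) v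
  have hfst : HasMFDerivAt 𝓘(ℝ, Phase n) (𝓡 n) (Prod.fst : Phase n → Base n) z
      (ContinuousLinearMap.fst ℝ (Base n) (Base n)) := hasFDerivAt_fst.hasMFDerivAt
  have h2 := mfderiv_comp_apply z (f := (Prod.fst : Phase n → Base n)) (g := e.symm)
    ((mdifferentiable_of_mem_maximalAtlas he).mdifferentiableAt_symm hz) hfst.mdifferentiableAt v
  rw [hfst.mfderiv] at h2
  exact h1.symm.trans h2

theorem mfderiv_coords_fst (he : e ∈ IsManifold.maximalAtlas (𝓡 n) ∞ M)
    {q : TangentBundle (𝓡 n) M} (hq : q.proj ∈ e.source) (ξ : TangentSpace (𝓡 n).tangent q) :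
    (mfderiv (𝓡 n).tangent 𝓘(ℝ, Phase n) (coords e) q ξ : Phase n).1
      = mfderiv (𝓡 n) (𝓡 n) e q.proj (mfderiv (𝓡 n).tangent (𝓡 n)
        (TotalSpace.proj : TangentBundle (𝓡 n) M → M) q ξ) := by
  have h1 := mfderiv_comp_apply q
    ((mdifferentiable_of_mem_maximalAtlas he).mdifferentiableAt hq) (mdifferentiableAt_proj q) ξ
  have hfst : HasMFDerivAt 𝓘(ℝ, Phase n) (𝓡 n) (Prod.fst : Phase n → Base n) (coords e q)
      (ContinuousLinearMap.fst ℝ (Base n) (Base n)) := hasFDerivAt_fst.hasMFDerivAt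
  have h2 := mfderiv_comp_apply q (g := (Prod.fst : Phase n → Base n)) (f := coords e)
    hfst.mdifferentiableAt (mdifferentiableAt_coords he hq) ξ
  rw [hfst.mfderiv] at h2
  exact h2.symm.trans h1

end Charts

section Main

open Bundle

variable {M : Type*} [TopologicalSpace M] [ChartedSpace (Base n) M] [IsManifold (𝓡 n) ∞ M]
  {e e' : OpenPartialHomeomorph M (Base n)} {z : Phase n} {U : Set M} {Γ : TVectorField n M}

/-! ### Sprays, 1-forms and multipliers in induced coordinates -/

theorem IsSpray.inChart_fst (hΓ : IsSpray Γ) (he : e ∈ IsManifold.maximalAtlas (𝓡 n) ∞ M)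
    (hz : z ∈ slitDomain U e) : (Γ.inChart e z).1 = z.2 := by
  have h1 := mfderiv_coords_fst he (q := param e z) (e.map_target hz.1) (Γ (param e z))
  rw [hΓ.second_order (param e z) (param_snd_ne_zero he hz)] at h1
  exact h1.trans (mfderiv_chart_symm_apply he hz.1 z.2)

theorem sprayCoeff_inChart_snd (z : Phase n) (i : Fin n) :
    (Γ.inChart e z).2 i = -2 * sprayCoeff Γ e i z := by
  rw [sprayCoeff]; ring

theorem IsSpray.contDiffOn_sprayCoeff (hΓ : IsSpray Γ)
    (he : e ∈ IsManifold.maximalAtlas (𝓡 n) ∞ M) (i : Fin n) :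
    ContDiffOn ℝ ∞ (sprayCoeff Γ e i) (slitDomain U e) :=
  contDiffOn_const.mul ((contDiff_fiberCoord i).comp_contDiffOn
    ((hΓ.smooth e he).mono fun _ hz => mem_slitDomain_univ hz))

/-- The spray coefficients are homogeneous of degree two. -/
theorem IsSpray.sum_fiberCoord_mul_V (hΓ : IsSpray Γ)
    (he : e ∈ IsManifold.maximalAtlas (𝓡 n) ∞ M) (hz : z ∈ slitDomain U e) (i : Fin n) :
    ∑ k, z.2 k * V k (sprayCoeff Γ e i) z = 2 * sprayCoeff Γ e i z := by
  have hd := (hΓ.smooth e he).differentiableAt_of_isOpen (isOpen_slitDomain isOpen_univ e)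
    (mem_slitDomain_univ hz)
  have h1 : HasFDerivAt (liouville : Phase n → Phase n)
      ((0 : Phase n →L[ℝ] Base n).prod (ContinuousLinearMap.snd ℝ (Base n) (Base n))) z :=
    (hasFDerivAt_const 0 z).prodMk hasFDerivAt_snd
  have h2 := hΓ.bracket e he z (mem_slitDomain_univ hz)
  rw [VectorField.lieBracket, h1.fderiv, sub_eq_iff_eq_add] at h2
  have h3 : (fderiv ℝ (Γ.inChart e) z (0, z.2)).2 i = 2 * (Γ.inChart e z).2 i := by
    have := congrArg (fun w : Phase n => w.2 i) h2
    simp only [liouville, Prod.snd_add, PiLp.add_apply, ContinuousLinearMap.prod_apply,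
      ContinuousLinearMap.coe_snd'] at this
    linarith
  have h4 : HasFDerivAt (fun w => (Γ.inChart e w).2 i)
      ((coordCovector i).comp ((ContinuousLinearMap.snd ℝ (Base n) (Base n)).comp
        (fderiv ℝ (Γ.inChart e) z))) z :=
    (coordCovector i).hasFDerivAt.comp z hd.hasFDerivAt.snd
  have h5 : fderiv ℝ (sprayCoeff Γ e i) z (0, z.2)
      = -(1 / 2) * (fderiv ℝ (Γ.inChart e) z (0, z.2)).2 i := by
    have h6 : HasFDerivAt (sprayCoeff Γ e i) _ z := h4.const_mul (-(1 / 2))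
    rw [h6.fderiv]
    rfl
  rw [← fderiv_vertical_eq_sum, h5, h3, sprayCoeff]
  ring

theorem IsSemiBasicOn.inChart_vertical {θ : TOneForm n M} (hθ : IsSemiBasicOn U θ)
    (he : e ∈ IsManifold.maximalAtlas (𝓡 n) ∞ M) (hz : z ∈ slitDomain U e) (b : Base n) :
    θ.inChart e z (0, b) = 0 := by
  refine hθ.semibasic (param e z) hz.2.1 (param_snd_ne_zero he hz) _ ?_
  refine (mfderiv_proj_mfderiv_param he hz.1 (0, b)).trans ?_
  exact map_zero (mfderiv (𝓡 n) (𝓡 n) e.symm z.1 : Base n →L[ℝ] Base n)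

theorem V_formComp {D : Set (Phase n)} {Θ : Phase n → Phase n →L[ℝ] ℝ} (hD : IsOpen D)
    (hΘ : ContDiffOn ℝ ∞ Θ D) (hz : z ∈ D) (i j : Fin n) :
    V i (formComp Θ j) z
      = fderiv ℝ Θ z (0, EuclideanSpace.single i 1) (EuclideanSpace.single j 1, 0) := by
  unfold V formComp
  rw [fderiv_clm_apply (hΘ.differentiableAt_of_isOpen hD hz) (differentiableAt_const _)]
  simp [ddx, ddy]

/-! ### The Helmholtz conditions for the vertical derivative of a 1-form -/

/-- The bilinear form `(u, v) ↦ T((0, L u), (L v, 0))` on the model space. -/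
def vertBilin (T : Phase n →L[ℝ] Phase n →L[ℝ] ℝ) (L : Base n →L[ℝ] Base n) :
    LinearMap.BilinForm ℝ (Base n) :=
  LinearMap.mk₂ ℝ
    (fun u v => T (ContinuousLinearMap.inr ℝ (Base n) (Base n) (L u))
      (ContinuousLinearMap.inl ℝ (Base n) (Base n) (L v)))
    (fun u u' v => by rw [map_add, map_add, map_add, add_apply])
    (fun c u v => by rw [map_smul, map_smul, map_smul, smul_apply])
    (fun u v v' => by rw [map_add, map_add, map_add])
    (fun c u v => by rw [map_smul, map_smul, map_smul])

/-- The tensor field along the projection with components `Vᵢ(θⱼ)`, evaluated in the preferred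
chart at the base point. -/
def vertDeriv (θ : TOneForm n M) : Multiplier n M := fun q =>
  vertBilin
    (fderiv ℝ (θ.inChart (chartAt (Base n) q.proj)) (coords (chartAt (Base n) q.proj) q))
    (mfderiv (𝓡 n) (𝓡 n) (chartAt (Base n) q.proj) q.proj)

theorem isVerticalDerivOn_vertDeriv (hU : IsOpen U) {θ : TOneForm n M}
    (hθ : IsSemiBasicOn U θ) : IsVerticalDerivOn U θ (vertDeriv θ) := by
  intro e he z hz i j
  set e₀ := chartAt (Base n) (e.symm z.1) with he₀'
  have he₀ : e₀ ∈ IsManifold.maximalAtlas (𝓡 n) ∞ M := IsManifold.chart_mem_maximalAtlas _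
  have hz₀ : z.1 ∈ transitionDomain e e₀ := ⟨hz.1, mem_chart_source _ _⟩
  have hO := isOpen_transitionDomain e e₀
  have hD := isOpen_slitDomain hU e₀
  have hD' : IsOpen (slitDomain U e ∩ Prod.fst ⁻¹' transitionDomain e e₀) :=
    (isOpen_slitDomain hU e).inter (hO.preimage continuous_fst)
  have key := vertDeriv_pullback (Θ := θ.inChart e₀) (Θ' := θ.inChart e) hD hD' hO
    (contDiffOn_chartTransition he he₀) (fun w hw => hw.2) (hθ.smooth e₀ he₀)
    (fun w hw => tangentTransition_mem_slitDomain he he₀ hw.1 hw.2)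
    (fun w hw b => hθ.inChart_vertical he₀ hw b) (fun w hw => TOneForm.inChart_eq he he₀ hw.2 θ)
    ⟨hz, hz₀⟩ (EuclideanSpace.single j 1) (EuclideanSpace.single i 1)
  have h1 : θ.comp e j = formComp (θ.inChart e) j := rfl
  rw [h1, V_formComp (isOpen_slitDomain hU e) (hθ.smooth e he) hz, key,
    fderiv_chartTransition he he₀ hz₀, fderiv_chartTransition he he₀ hz₀,
    ← coords_param_eq_tangentTransition he he₀ hz₀]
  rfl

theorem isSmoothMultiplierOn_vertDeriv (hU : IsOpen U) {θ : TOneForm n M}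
    (hθ : IsSemiBasicOn U θ) : IsSmoothMultiplierOn U (vertDeriv θ) := fun e he i j =>
  (contDiffOn_V (isOpen_slitDomain hU e) (contDiffOn_formComp (hθ.smooth e he) j) i).congr
    fun z hz => isVerticalDerivOn_vertDeriv hU hθ e he z hz i j

/-- The differential conditions on a semi-basic 1-form, in components. -/
theorem differentialConditionsOn_iff (hU : IsOpen U) {θ : TOneForm n M}
    (hθ : IsSemiBasicOn U θ) :
    DifferentialConditionsOn Γ U θ ↔ ∀ e ∈ IsManifold.maximalAtlas (𝓡 n) ∞ M,
      ∀ z ∈ slitDomain U e,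
        (∀ j, ∑ k, z.2 k * V k (θ.comp e j) z = 0) ∧
        (∀ i j, V i (θ.comp e j) z = V j (θ.comp e i) z) ∧
        ∀ i j, horCurl (sprayCoeff Γ e) (θ.comp e) i j z = 0 := by
  have hL := fun e (he : e ∈ IsManifold.maximalAtlas (𝓡 n) ∞ M) z (hz : z ∈ slitDomain U e) =>
    lieD_liouville_eq (isOpen_slitDomain hU e) (hθ.smooth e he)
      (fun w hw b => hθ.inChart_vertical he hw b) hz
  have hJ := fun e (he : e ∈ IsManifold.maximalAtlas (𝓡 n) ∞ M) z (hz : z ∈ slitDomain U e) =>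
    extDAlong_tangentStructure_eq (isOpen_slitDomain hU e) (hθ.smooth e he)
      (fun w hw b => hθ.inChart_vertical he hw b) hz
  have hH := fun e (he : e ∈ IsManifold.maximalAtlas (𝓡 n) ∞ M) z (hz : z ∈ slitDomain U e) =>
    extDAlong_horProj_eq (G := sprayCoeff Γ e) (isOpen_slitDomain hU e) (hθ.smooth e he)
      (fun w hw b => hθ.inChart_vertical he hw b) hz
  have hc : ∀ e j, θ.comp e j = formComp (θ.inChart e) j := fun _ _ => rfl
  have hc' : ∀ e, θ.comp e = formComp (θ.inChart e) := fun _ => rfl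
  constructor
  · intro h e he z hz
    refine ⟨fun j => ?_, fun i j => ?_, fun i j => ?_⟩
    · have := h.lie e he z hz (ddx j)
      rw [hL e he z hz] at this
      simpa [ddx, Pi.single_apply, hc] using this
    · have := h.dJ e he z hz (ddx i) (ddx j)
      rw [hJ e he z hz] at this
      simpa [ddx, Pi.single_apply, hc, sub_eq_zero] using this
    · have := h.dH e he z hz (ddx i) (ddx j)
      rw [hH e he z hz] at this
      simpa [ddx, Pi.single_apply, hc'] using this
  · intro h
    refine ⟨fun e he z hz v => ?_, fun e he z hz u v => ?_, fun e he z hz u v => ?_⟩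
    · rw [hL e he z hz]
      exact Finset.sum_eq_zero fun j _ => by
        rw [← hc, (h e he z hz).1 j, mul_zero]
    · rw [hJ e he z hz]
      exact Finset.sum_eq_zero fun i _ => Finset.sum_eq_zero fun j _ => by
        rw [← hc, ← hc, (h e he z hz).2.1 i j, sub_self, mul_zero]
    · rw [hH e he z hz]
      exact Finset.sum_eq_zero fun i _ => Finset.sum_eq_zero fun j _ => by
        rw [← hc', (h e he z hz).2.2 i j, mul_zero]

/-- The vertical derivative of a 1-form that satisfies the differential conditions satisfies the
Helmholtz conditions: `∇h = 0` is the structure equation for `d_H θ = 0`, and the Weyl condition is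
the contraction of `d_H d_H θ = 0` with `y`. -/
theorem helmholtzOn_of_isVerticalDerivOn (hΓ : IsSpray Γ) (hU : IsOpen U) {θ : TOneForm n M}
    (hθ : IsSemiBasicOn U θ) (hc : DifferentialConditionsOn Γ U θ) {h : Multiplier n M}
    (hh : IsVerticalDerivOn U θ h) : HelmholtzOn Γ U h := by
  rw [differentialConditionsOn_iff hU hθ] at hc
  have hZ := fun e he z hz => (hc e he z hz).1
  have hS := fun e he z hz => (hc e he z hz).2.1
  have hω := fun e he z hz => (hc e he z hz).2.2
  have hsm : ∀ e ∈ IsManifold.maximalAtlas (𝓡 n) ∞ M, ∀ j,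
      ContDiffOn ℝ ∞ (θ.comp e j) (slitDomain U e) := fun e he j =>
    contDiffOn_formComp (hθ.smooth e he) j
  have hV : ∀ e ∈ IsManifold.maximalAtlas (𝓡 n) ∞ M, ∀ z ∈ slitDomain U e, ∀ i j k,
      V k (h.comp e i j) z = V k (V i (θ.comp e j)) z := fun e he z hz i j k =>
    V_eq_of_eqOn (isOpen_slitDomain hU e) (fun w hw => hh e he w hw i j) hz k
  have hsymm : ∀ e ∈ IsManifold.maximalAtlas (𝓡 n) ∞ M, ∀ z ∈ slitDomain U e, ∀ i j,
      h.comp e j i z = h.comp e i j z := fun e he z hz i j => by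
    rw [hh e he z hz, hh e he z hz, hS e he z hz]
  have hy : ∀ e ∈ IsManifold.maximalAtlas (𝓡 n) ∞ M, ∀ z ∈ slitDomain U e, ∀ i,
      ∑ j, z.2 j * h.comp e i j z = 0 := fun e he z hz i => by
    rw [← hZ e he z hz i]
    exact Finset.sum_congr rfl fun j _ => by rw [hh e he z hz, hS e he z hz]
  refine ⟨hsymm, fun e he z hz i => ?_, fun e he z hz i j k => ?_, fun e he z hz i j => ?_,
    fun e he z hz i j => ?_⟩
  · rw [← hy e he z hz i]
    exact Finset.sum_congr rfl fun j _ => mul_comm _ _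
  · have hD := isOpen_slitDomain hU e
    rw [hV e he z hz, hV e he z hz, V_comm hD (hsm e he j) hz, V_comm hD (hsm e he k) hz]
    exact V_eq_of_eqOn hD (fun w hw => hS e he w hw k j) hz i
  · have hD := isOpen_slitDomain hU e
    have hN := nabla_vertDeriv_eq hD (fun i => hΓ.contDiffOn_sprayCoeff he i)
      (fun w hw i => hΓ.sum_fiberCoord_mul_V he hw i) (hsm e he) (hS e he) (hZ e he) hz i j
    have h0 : ∀ k, V i (horCurl (sprayCoeff Γ e) (θ.comp e) k j) z = 0 := fun k => by
      rw [V_eq_of_eqOn hD (g := fun _ => 0) (fun w hw => hω e he w hw k j) hz]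
      simp [V]
    simp only [h0, mul_zero, Finset.sum_const_zero] at hN
    rw [nabla, Set.EqOn.fderiv_eq_of_isOpen hD (fun w hw => hh e he w hw i j) hz,
      fderiv_spray_eq_sum_H (D := slitDomain U e)
        (fun w hw i => hΓ.sum_fiberCoord_mul_V he hw i) hz (hΓ.inChart_fst he hz)
        (fun i => sprayCoeff_inChart_snd z i)]
    simp only [hh e he z hz]
    exact hN.symm
  · have hD := isOpen_slitDomain hU e
    rw [weyl_symm_iff (h := fun i j => h.comp e i j z) (hsymm e he z hz) (hy e he z hz),
      ← contract_cyclic_curvature (h := fun i j => h.comp e i j z) (hy e he z hz)]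
    refine Finset.sum_eq_zero fun k _ => ?_
    have hC := cyclic_H_horCurl hD (fun i => hΓ.contDiffOn_sprayCoeff he i) (hsm e he) hz i j k
    have h0 : ∀ a b c, H (sprayCoeff Γ e) a (horCurl (sprayCoeff Γ e) (θ.comp e) b c) z = 0 :=
      fun a b c => by
        rw [H_eq_of_eqOn hD (g := fun _ => 0) (fun w hw => hω e he w hw b c) hz]
        simp [H]
    rw [h0, h0, h0] at hC
    simp only [hh e he z hz]
    rw [show _ + _ + _ = (0 : ℝ) by linarith, mul_zero]

end Main

/-! ### From a multiplier to a 1-form -/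

section Converse

open Bundle

variable {M : Type*} [TopologicalSpace M] [ChartedSpace (Base n) M] [IsManifold (𝓡 n) ∞ M]
  {e e' : OpenPartialHomeomorph M (Base n)} {z : Phase n} {U : Set M} {Γ : TVectorField n M}

/-- The semi-basic 1-form `θⱼ dxʲ` in coordinates. -/
def formOfComp (θ : Fin n → Phase n → ℝ) (z : Phase n) : Phase n →L[ℝ] ℝ := ∑ j, θ j z • dx j

theorem formOfComp_apply (θ : Fin n → Phase n → ℝ) (z v : Phase n) :
    formOfComp θ z v = ∑ j, θ j z * v.1 j := by
  simp [formOfComp, sum_apply, dx]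

theorem formComp_formOfComp (θ : Fin n → Phase n → ℝ) : formComp (formOfComp θ) = θ := by
  funext j z
  simp [formComp, formOfComp_apply, ddx]

/-- The 1-form on the tangent bundle with a given expression in the coordinates of one chart. -/
def formOfChart (e : OpenPartialHomeomorph M (Base n)) (Θ : Phase n → Phase n →L[ℝ] ℝ) :
    TOneForm n M := fun q =>
  (Θ (coords e q)).comp (mfderiv (𝓡 n).tangent 𝓘(ℝ, Phase n) (coords e) q)

theorem formOfChart_inChart (he : e ∈ IsManifold.maximalAtlas (𝓡 n) ∞ M)
    (he' : e' ∈ IsManifold.maximalAtlas (𝓡 n) ∞ M) (hz : z.1 ∈ transitionDomain e' e)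
    (Θ : Phase n → Phase n →L[ℝ] ℝ) :
    (formOfChart e Θ).inChart e' z = (Θ (tangentTransition (chartTransition e' e) z)).comp
      (fderiv ℝ (tangentTransition (chartTransition e' e)) z) := by
  have h1 : coords e ∘ param e' =ᶠ[nhds z] tangentTransition (chartTransition e' e) := by
    filter_upwards [eventually_mem_transitionDomain hz] with w hw
    exact coords_param_eq_tangentTransition he' he hw
  have h2 : coords e (param e' z) = tangentTransition (chartTransition e' e) z :=
    coords_param_eq_tangentTransition he' he hz
  refine ContinuousLinearMap.ext fun v => ?_
  have h3 := mfderiv_comp_apply z (mdifferentiableAt_coords he (q := param e' z) hz.2)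
    (mdifferentiableAt_param he' hz.1) v
  rw [mfderiv_eq_fderiv, h1.fderiv_eq] at h3
  rw [ContinuousLinearMap.comp_apply, ← h2]
  exact congrArg (Θ (coords e (param e' z))) h3.symm

theorem isSemiBasicOn_formOfChart (he : e ∈ IsManifold.maximalAtlas (𝓡 n) ∞ M) (hU : IsOpen U)
    (hUe : U ⊆ e.source) {θ : Fin n → Phase n → ℝ}
    (hθ : ∀ j, ContDiffOn ℝ ∞ (θ j) (slitDomain U e)) :
    IsSemiBasicOn U (formOfChart e (formOfComp θ)) := by
  refine ⟨fun e' he' => ?_, fun q hq _ ξ hξ => ?_⟩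
  · have hm : ∀ z ∈ slitDomain U e', z.1 ∈ transitionDomain e' e := fun z hz =>
      ⟨hz.1, hUe hz.2.1⟩
    exact contDiffOn_of_pullback (Θ := formOfComp θ) (isOpen_slitDomain hU e')
      (contDiffOn_sum_smul_const hθ)
      ((contDiffOn_tangentTransition (isOpen_transitionDomain e' e)
        (contDiffOn_chartTransition he' he)).mono hm)
      (fun z hz => tangentTransition_mem_slitDomain he' he hz (hm z hz))
      (fun z hz => formOfChart_inChart he he' (hm z hz) _)
  · have h1 := mfderiv_coords_fst he (hUe hq) ξ
    have h2 : (mfderiv (𝓡 n).tangent 𝓘(ℝ, Phase n) (coords e) q ξ : Phase n).1 = 0 := by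
      refine h1.trans ?_
      rw [hξ]
      exact map_zero (mfderiv (𝓡 n) (𝓡 n) e q.proj : Base n →L[ℝ] Base n)
    refine (formOfComp_apply θ (coords e q)
      (mfderiv (𝓡 n).tangent 𝓘(ℝ, Phase n) (coords e) q ξ)).trans ?_
    exact Finset.sum_eq_zero fun j _ => by rw [h2, PiLp.zero_apply, mul_zero]

/-- A chart expression of `Vᵢ(θⱼ) = hᵢⱼ` in one chart holds in every chart. -/
theorem isVerticalDerivOn_formOfChart (he : e ∈ IsManifold.maximalAtlas (𝓡 n) ∞ M)
    (hU : IsOpen U) (hUe : U ⊆ e.source) {θ : Fin n → Phase n → ℝ}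
    (hθ : ∀ j, ContDiffOn ℝ ∞ (θ j) (slitDomain U e)) {h : Multiplier n M}
    (hh : ∀ z ∈ slitDomain U e, ∀ i j, V i (θ j) z = h.comp e i j z) :
    IsVerticalDerivOn U (formOfChart e (formOfComp θ)) h := by
  intro e' he' z hz i j
  have hsb := isSemiBasicOn_formOfChart he hU hUe hθ
  have hm : ∀ z ∈ slitDomain U e', z.1 ∈ transitionDomain e' e := fun z hz =>
    ⟨hz.1, hUe hz.2.1⟩
  have hD := isOpen_slitDomain hU e
  have hΘ : ContDiffOn ℝ ∞ (formOfComp θ) (slitDomain U e) := contDiffOn_sum_smul_const hθ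
  have hv : ∀ w ∈ slitDomain U e, ∀ b, formOfComp θ w (0, b) = 0 := fun w _ b => by
    simp [formOfComp_apply]
  have hφz := tangentTransition_mem_slitDomain he' he hz (hm z hz)
  have key := vertDeriv_pullback hD (isOpen_slitDomain hU e') (isOpen_transitionDomain e' e)
    (contDiffOn_chartTransition he' he) hm hΘ
    (fun w hw => tangentTransition_mem_slitDomain he' he hw (hm w hw)) hv
    (fun w hw => formOfChart_inChart he he' (hm w hw) _) hz
    (EuclideanSpace.single j 1) (EuclideanSpace.single i 1)
  have h1 : (formOfChart e (formOfComp θ)).comp e' j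
    = formComp ((formOfChart e (formOfComp θ)).inChart e') j := rfl
  rw [h1, V_formComp (isOpen_slitDomain hU e') (hsb.smooth e' he') hz, key,
    fderiv_apply_eq_sum_formComp hD hΘ hv hφz, formComp_formOfComp]
  have h2 : ∀ v : Base n, (mfderiv (𝓡 n) (𝓡 n) e'.symm z.1 v : Base n)
      = mfderiv (𝓡 n) (𝓡 n) e.symm (tangentTransition (chartTransition e' e) z).1
        (fderiv ℝ (chartTransition e' e) z.1 v) := fun v =>
    (mfderiv_symm_fderiv_chartTransition he' he (hm z hz) v).symm
  have h3 := h.congr_point (param_tangentTransition he' he (hm z hz))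
    (mfderiv (𝓡 n) (𝓡 n) e'.symm z.1 (EuclideanSpace.single i (1 : ℝ)))
    (mfderiv (𝓡 n) (𝓡 n) e'.symm z.1 (EuclideanSpace.single j (1 : ℝ)))
  refine h3.symm.trans ?_
  rw [h2, h2]
  refine (h.apply_eq_sum e _ _ _).trans ?_
  simp only [fderiv_vertical_eq_sum, hh _ hφz, Finset.mul_sum]
  rw [Finset.sum_comm]
  exact Finset.sum_congr rfl fun k _ => Finset.sum_congr rfl fun l _ => by ring

/-- If `Hᵢ(θⱼ) = Hⱼ(θᵢ)` in one chart and `hᵢⱼ = Vᵢ(θⱼ)` satisfies the Helmholtz conditions, then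
all differential conditions hold in every chart. The contraction of `dθ` with the spray is
invariant, and determines `d_H θ` because `∇h = 0`. -/
theorem differentialConditionsOn_formOfChart (hΓ : IsSpray Γ)
    (he : e ∈ IsManifold.maximalAtlas (𝓡 n) ∞ M) (hU : IsOpen U) (hUe : U ⊆ e.source)
    {θ : Fin n → Phase n → ℝ} (hθ : ∀ j, ContDiffOn ℝ ∞ (θ j) (slitDomain U e))
    {h : Multiplier n M} (hh : ∀ z ∈ slitDomain U e, ∀ i j, V i (θ j) z = h.comp e i j z)
    (hω : ∀ z ∈ slitDomain U e, ∀ i j, horCurl (sprayCoeff Γ e) θ i j z = 0)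
    (hH : HelmholtzOn Γ U h) :
    DifferentialConditionsOn Γ U (formOfChart e (formOfComp θ)) := by
  have hsb := isSemiBasicOn_formOfChart he hU hUe hθ
  have hvd := isVerticalDerivOn_formOfChart he hU hUe hθ hh
  have hS : ∀ e' ∈ IsManifold.maximalAtlas (𝓡 n) ∞ M, ∀ z ∈ slitDomain U e', ∀ i j,
      V i ((formOfChart e (formOfComp θ)).comp e' j) z
        = V j ((formOfChart e (formOfComp θ)).comp e' i) z := fun e' he' z hz i j => by
    rw [← hvd e' he' z hz, ← hvd e' he' z hz, hH.symm e' he' z hz]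
  have hZ : ∀ e' ∈ IsManifold.maximalAtlas (𝓡 n) ∞ M, ∀ z ∈ slitDomain U e', ∀ j,
      ∑ k, z.2 k * V k ((formOfChart e (formOfComp θ)).comp e' j) z = 0 :=
    fun e' he' z hz j => by
      rw [← hH.contract e' he' z hz j]
      exact Finset.sum_congr rfl fun k _ => by
        rw [← hvd e' he' z hz, hH.symm e' he' z hz, mul_comm]
  rw [differentialConditionsOn_iff hU hsb]
  intro e' he' z hz
  refine ⟨hZ e' he' z hz, hS e' he' z hz, fun i j => ?_⟩
  have hm : ∀ z ∈ slitDomain U e', z.1 ∈ transitionDomain e' e := fun z hz =>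
    ⟨hz.1, hUe hz.2.1⟩
  have hD := isOpen_slitDomain hU e
  have hD' := isOpen_slitDomain hU e'
  have hsm : ∀ j, ContDiffOn ℝ ∞ ((formOfChart e (formOfComp θ)).comp e' j) (slitDomain U e') :=
    fun j => contDiffOn_formComp (hsb.smooth e' he') j
  have hG := fun i => hΓ.contDiffOn_sprayCoeff (U := U) he' i
  have hE := fun z (hz : z ∈ slitDomain U e') i => hΓ.sum_fiberCoord_mul_V he' hz i
  have hΘ : ContDiffOn ℝ ∞ (formOfComp θ) (slitDomain U e) := contDiffOn_sum_smul_const hθ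
  refine horCurl_eq_zero_of_contract hD' hG hsm (fun w hw i j => ?_) (fun w hw j => ?_) hz i j
  · rw [nabla_vertDeriv_eq hD' hG hE hsm (hS e' he') (hZ e' he') hw,
      ← hH.nabla_eq_zero e' he' w hw i j, nabla,
      Set.EqOn.fderiv_eq_of_isOpen hD' (fun v hv => hvd e' he' v hv i j) hw,
      fderiv_spray_eq_sum_H hE hw (hΓ.inChart_fst he' hw)
        (fun i => sprayCoeff_inChart_snd w i)]
    simp only [hvd e' he' w hw]
  · have hφw := tangentTransition_mem_slitDomain he' he hw (hm w hw)
    -- Both sides of the invariance of `i_Γ dθ`, computed in the charts `e'` and `e`.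
    have h1 := extD_spray_eq hD' (hsb.smooth e' he')
      (fun v hv b => hsb.inChart_vertical he' hv b) hE (hS e' he') (hZ e' he') hw
      (hΓ.inChart_fst he' hw) (fun i => sprayCoeff_inChart_snd w i) (ddx j)
    have h2 := extD_pullback hD hD' hΘ
      ((contDiffOn_tangentTransition (isOpen_transitionDomain e' e)
        (contDiffOn_chartTransition he' he)).mono hm)
      (fun z hz => tangentTransition_mem_slitDomain he' he hz (hm z hz))
      (fun z hz => formOfChart_inChart he he' (hm z hz) _) hw (Γ.inChart e' w) (ddx j)
    rw [← TVectorField.inChart_eq he' he (hm w hw), extD_spray_eq (G := sprayCoeff Γ e) hD hΘ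
      (fun v _ b => by simp [formOfComp_apply])
      (fun z hz i => hΓ.sum_fiberCoord_mul_V he hz i)
      (fun v hv i j => by
        rw [formComp_formOfComp, hh v hv, hh v hv, hH.symm e he v hv])
      (fun v hv j => by
        rw [formComp_formOfComp, ← hH.contract e he v hv j]
        exact Finset.sum_congr rfl fun k _ => by
          rw [hh v hv, hH.symm e he v hv, mul_comm])
      hφw (hΓ.inChart_fst he hφw) (fun i => sprayCoeff_inChart_snd _ i)] at h2
    simp only [formComp_formOfComp, hω _ hφw, mul_zero, Finset.sum_const_zero] at h2
    rw [h2] at h1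
    simp only [ddx, PiLp.single_apply, ite_mul, one_mul, zero_mul, Finset.sum_ite_eq',
      Finset.mem_univ, if_true] at h1
    exact h1.symm

/-- The coordinate construction applied on the preimage of a ball in a chart around `p`, whose slit
domain is a product of the ball with the slit fibre. -/
theorem exists_local_form (hn : 3 ≤ n) (hΓ : IsSpray Γ) (hU : IsOpen U) {h : Multiplier n M}
    (hsm : IsSmoothMultiplierOn U h) (hH : HelmholtzOn Γ U h) {p : M} (hp : p ∈ U) :
    ∃ W : Set M, IsOpen W ∧ p ∈ W ∧ W ⊆ U ∧ ∃ θ : TOneForm n M,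
      IsSemiBasicOn W θ ∧ DifferentialConditionsOn Γ W θ ∧ IsVerticalDerivOn W θ h := by
  set e := chartAt (Base n) p with he_def
  have he : e ∈ IsManifold.maximalAtlas (𝓡 n) ∞ M := IsManifold.chart_mem_maximalAtlas p
  have hpe : p ∈ e.source := mem_chart_source _ p
  obtain ⟨r, hr, hball⟩ := Metric.isOpen_iff.1 (e.isOpen_inter_preimage_symm hU) (e p)
    ⟨e.map_source hpe, by
      change e.symm (e p) ∈ U
      rwa [e.left_inv hpe]⟩
  set B := Metric.ball (e p) r
  have hW : IsOpen (e.source ∩ e ⁻¹' B) := e.isOpen_inter_preimage Metric.isOpen_ball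
  have hWU : e.source ∩ e ⁻¹' B ⊆ U := fun q hq => by
    have := (hball hq.2).2
    rwa [Set.mem_preimage, e.left_inv hq.1] at this
  set W := e.source ∩ e ⁻¹' B
  have hslit : slitDomain W e = B ×ˢ ({0}ᶜ : Set (Base n)) := by
    ext z
    constructor
    · rintro ⟨h1, h2, h3⟩
      have := h2.2
      rw [Set.mem_preimage, e.right_inv h1] at this
      exact ⟨this, h3⟩
    · rintro ⟨h1, h2⟩
      have h3 := (hball h1).1
      refine ⟨h3, ⟨e.map_target h3, ?_⟩, h2⟩
      rwa [Set.mem_preimage, e.right_inv h3]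
  have hsub : ∀ e' : OpenPartialHomeomorph M (Base n), slitDomain W e' ⊆ slitDomain U e' :=
    fun e' z hz => ⟨hz.1, hWU hz.2.1, hz.2.2⟩
  have hHW : HelmholtzOn Γ W h :=
    ⟨fun e' he' z hz => hH.symm e' he' z (hsub e' hz),
      fun e' he' z hz => hH.contract e' he' z (hsub e' hz),
      fun e' he' z hz => hH.vertical e' he' z (hsub e' hz),
      fun e' he' z hz => hH.nabla_eq_zero e' he' z (hsub e' hz),
      fun e' he' z hz => hH.weyl_symm e' he' z (hsub e' hz)⟩
  have hex := exists_local_potential (G := sprayCoeff Γ e) (h := h.comp e) hn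
    (B := B) Metric.isOpen_ball (convex_ball _ _) (Metric.mem_ball_self hr)
  rw [← hslit] at hex
  obtain ⟨θ, hθ, hθh, hθω⟩ := hex (fun i => hΓ.contDiffOn_sprayCoeff he i)
    (fun z hz i => hΓ.sum_fiberCoord_mul_V he hz i)
    (fun i j => (hsm e he i j).mono (hsub e))
    (hHW.symm e he)
    (fun z hz i => by
      rw [← hHW.contract e he z hz i]
      exact Finset.sum_congr rfl fun j _ => mul_comm _ _)
    (hHW.vertical e he)
    (fun z hz i j => by
      rw [← hHW.nabla_eq_zero e he z hz i j, nabla, fderiv_spray_eq_sum_H (D := slitDomain W e)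
        (fun w hw i => hΓ.sum_fiberCoord_mul_V he hw i) hz (hΓ.inChart_fst he hz)
        (fun i => sprayCoeff_inChart_snd z i)])
    (hHW.weyl_symm e he)
  have hWe : W ⊆ e.source := Set.inter_subset_left
  exact ⟨W, hW, ⟨hpe, Metric.mem_ball_self hr⟩, hWU, formOfChart e (formOfComp θ),
    isSemiBasicOn_formOfChart he hW hWe hθ,
    differentialConditionsOn_formOfChart hΓ he hW hWe hθ hθh hθω hHW,
    isVerticalDerivOn_formOfChart he hW hWe hθ hθh⟩

end Converse

end SprayGeometry

end

theorem mainTheorem2 {n : ℕ} (hn : 3 ≤ n) {M : Type*} [TopologicalSpace M]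
    [ChartedSpace (EuclideanSpace ℝ (Fin n)) M] [IsManifold (𝓡 n) ∞ M]
    [T2Space M] [ParacompactSpace M]
    (Γ : SprayGeometry.TVectorField n M) (hΓ : SprayGeometry.IsSpray Γ)
    (U : Set M) (hU : IsOpen U) :
    (∀ θ : SprayGeometry.TOneForm n M,
      SprayGeometry.IsSemiBasicOn U θ →
      SprayGeometry.DifferentialConditionsOn Γ U θ →
      ∃ h : SprayGeometry.Multiplier n M,
        SprayGeometry.IsSmoothMultiplierOn U h ∧
        SprayGeometry.IsVerticalDerivOn U θ h ∧
        SprayGeometry.HelmholtzOn Γ U h) ∧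
    (∀ h : SprayGeometry.Multiplier n M,
      SprayGeometry.IsSmoothMultiplierOn U h →
      SprayGeometry.HelmholtzOn Γ U h →
      ∀ p ∈ U, ∃ W : Set M, IsOpen W ∧ p ∈ W ∧ W ⊆ U ∧
        ∃ θ : SprayGeometry.TOneForm n M,
          SprayGeometry.IsSemiBasicOn W θ ∧
          SprayGeometry.DifferentialConditionsOn Γ W θ ∧
          SprayGeometry.IsVerticalDerivOn W θ h) :=
  ⟨fun θ hθ hc => ⟨SprayGeometry.vertDeriv θ,
      SprayGeometry.isSmoothMultiplierOn_vertDeriv hU hθ,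
      SprayGeometry.isVerticalDerivOn_vertDeriv hU hθ,
      SprayGeometry.helmholtzOn_of_isVerticalDerivOn hΓ hU hθ hc
        (SprayGeometry.isVerticalDerivOn_vertDeriv hU hθ)⟩,
    fun _ hsm hH _ hp => SprayGeometry.exists_local_form hn hΓ hU hsm hH hp⟩
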